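/- **Theorem 3.** For a group $G$ with a finite generating set $\mathcal G$, let $\Gamma$ be the Cayley graph of $G$ with respect to $\mathcal G\cup\mathcal G^{-1}$ (vertices $g\in G$, edges joining $g$ to $ga$ for $a\in\mathcal G\cup\mathcal G^{-1}$), made into a metric space with path metric $d$ by giving each edge length one. Write $\ell(p)=d(1,p)$ for $p\in\Gamma$ and $B(n)=\{p\in\Gamma : \ell(p)\le n\}$. The group $G$ is *almost convex with respect to* $\mathcal G$ if for every integer $m\ge 0$ there is a constant $K(m)$ such that for all $n\ge 0$ and all $g,g'\in G$ with $\ell(g)=\ell(g')=n$ and $d(g,g')\le m$, there is an edge path in $\Gamma$ from $g$ to $g'$ that lies inside $B(n)$ and has length at most $K(m)$. Let $$N=\langle x,y \mid [[x,y],x]=[[x,y],y]=1\rangle,$$ and, for an integer $e\ge 1$, $$N^e=\langle x,y,z \mid [x,z]=[y,z]=1,\ [x,y]=z^e\rangle .$$ Then $N$ is almost convex with respect to $\{x,y\}$, and for every integer $e\ge 1$ the group $N^e$ is almost convex with respect to $\{x,y,z\}$. -/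

import Mathlib

namespace Nil

section AlmostConvex

variable {G : Type*} [Group G]

/-- The Cayley graph of `G` with respect to `S`: distinct vertices `g`, `h` are joined by an edge
iff `h = g * s` with `s ∈ S` or `s⁻¹ ∈ S`. -/
abbrev cayley (S : Set G) : SimpleGraph G := SimpleGraph.mulCayley S

/-- The word metric on `G`. -/
noncomputable def wordDist (S : Set G) (g h : G) : ℕ := (cayley S).dist g h

/-- The word length of an element of `G`. -/
noncomputable def wordLength (S : Set G) (g : G) : ℕ := wordDist S 1 g

/-- The distance, in the Cayley graph as a metric graph with edges of length one, from the vertex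
`1` to the point at parameter `t ∈ [0, 1]` of the edge from `u` to `v`: a shortest path to that
point passes through `u` or through `v`. -/
noncomputable def edgePointLength (S : Set G) (u v : G) (t : ℝ) : ℝ :=
  min ((wordLength S u : ℝ) + t) ((wordLength S v : ℝ) + (1 - t))

/-- The edge path `p` lies inside the ball of radius `n` around `1` in the metric Cayley graph:
all its vertices and all the points of its edges do. -/
def LiesInBall (S : Set G) (n : ℕ) {g h : G} (p : (cayley S).Walk g h) : Prop :=
  (∀ v ∈ p.support, wordLength S v ≤ n) ∧
    ∀ d ∈ p.darts, ∀ t ∈ Set.Icc (0 : ℝ) 1, edgePointLength S d.fst d.snd t ≤ n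

/-- Almost convexity `(m)`: a single constant `K` serves for all `n`, `g` and `g'`. -/
def AlmostConvexAt (S : Set G) (m : ℕ) : Prop :=
  ∃ K : ℕ, ∀ (n : ℕ) (g g' : G), wordLength S g = n → wordLength S g' = n → wordDist S g g' ≤ m →
    ∃ p : (cayley S).Walk g g', LiesInBall S n p ∧ p.length ≤ K

/-- `S` is a finite generating set of `G`, and `G` is almost convex with respect to `S`. -/
structure AlmostConvex (S : Set G) : Prop where
  finite : S.Finite
  generates : Subgroup.closure S = ⊤
  almostConvexAt : ∀ m : ℕ, AlmostConvexAt S m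

end AlmostConvex

open scoped commutatorElement in
/-- The relators of `⟨x, y | [[x, y], x] = [[x, y], y] = 1⟩`. -/
def relsN : Set (FreeGroup (Fin 2)) :=
  let x : FreeGroup (Fin 2) := FreeGroup.of 0
  let y : FreeGroup (Fin 2) := FreeGroup.of 1
  {⁅⁅x, y⁆, x⁆, ⁅⁅x, y⁆, y⁆}

/-- The group `N = ⟨x, y | [[x, y], x] = [[x, y], y] = 1⟩`. -/
abbrev N : Type := PresentedGroup relsN

/-- The generating set `{x, y}` of `N`. -/
def gensN : Set N := {PresentedGroup.of 0, PresentedGroup.of 1}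

open scoped commutatorElement in
/-- The relators of `⟨x, y, z | [x, z] = [y, z] = 1, [x, y] = z ^ e⟩`. -/
def relsNe (e : ℕ) : Set (FreeGroup (Fin 3)) :=
  let x : FreeGroup (Fin 3) := FreeGroup.of 0
  let y : FreeGroup (Fin 3) := FreeGroup.of 1
  let z : FreeGroup (Fin 3) := FreeGroup.of 2
  {⁅x, z⁆, ⁅y, z⁆, ⁅x, y⁆ * (z ^ e)⁻¹}

/-- The group `N^e = ⟨x, y, z | [x, z] = [y, z] = 1, [x, y] = z ^ e⟩`. -/
abbrev Ne (e : ℕ) : Type := PresentedGroup (relsNe e)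

/-- The generating set `{x, y, z}` of `N^e`. -/
def gensNe (e : ℕ) : Set (Ne e) :=
  {PresentedGroup.of 0, PresentedGroup.of 1, PresentedGroup.of 2}

end Nil

/-! In Heisenberg coordinates (a, b, t), with t twice the signed area between a plane path and its
chord, word length in `N` is an isoperimetric problem. A path of length n ending over (a, b) fits in
a box with sides p ≥ |a|, q ≥ |b| and perimeter at most n + |a| + |b|, so |t| ≤ 2pq - |a||b|.
Conversely, these bounds together with a parity condition give length at most n (`ball_of_wordLE`,
`wordLE_of_ball`). Balls are thus explicit, and invariant under the symmetries of the square.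

To join g and g' at distance m, follow one generator, say x, from both. Conjugation by x^r changes
only the central coordinate, by O(rm), so g x^r and g' x^r are only about √(rm) apart. If x^r leads
r steps down from both, then for r a large multiple of m these points are closer than 2r, and a
shortest path between them stays in the ball (`XGood.conn`, `Conn.of_depth`).

It remains to find, up to bounded moves, a common direction of descent. Going back along a shortest
path means following the boundary of its box. If the box can extend well beyond g, then x descends
(`Ball.mul_X`). If a side of the box must be close to g, one moves to that side and follows it
(`xReach_of_box`). If nearly all length lies in one coordinate, every geodesic runs mostly along it
(`xGood_of_thin`). Short elements are joined through the identity. When there is room, minimality of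
the length of g forces a large area (`lt_t_of_room`), so g' has area of the same sign and shares the
direction.

Interiors of edges must stay in the ball too. In `N` adjacent vertices have lengths of different
parity, so this is automatic.

In `N^e` an element of length n is h z^k with h from `N`, |k| ≤ 25e and total length at most n. A
path strips z^k, joins the two elements of `N` there, and restores the other power of z. Lengths in
`N` and `N^e` differ by a factor of at most 4 on the image of `N` (`wordLE_of_incl`). -/

namespace Nil

/-! ### Edge paths and word length in an arbitrary group -/

section EdgePath

variable {G' : Type*} [Group G'] {G : Type*} [Group G]

/-- The generators in `S` and their inverses. -/
def steps (S : Set G) : Set G := {s | s ∈ S ∨ s⁻¹ ∈ S}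

theorem inv_mem_steps {S : Set G} {s : G} (hs : s ∈ steps S) : s⁻¹ ∈ steps S := by
  rcases hs with h | h
  · exact Or.inr (by simpa using h)
  · exact Or.inl h

theorem map_mem_steps {S : Set G} {S' : Set G'} (f : G →* G') (hf : ∀ s ∈ S, f s ∈ S')
    {s : G} (hs : s ∈ steps S) : f s ∈ steps S' := by
  rcases hs with h | h
  · exact Or.inl (hf _ h)
  · exact Or.inr (by simpa using hf _ h)

/-- `EdgePath S E k g h`: there is an edge path of length at most `k` from `g` to `h`, using
generators from `S` and their inverses, all of whose edges satisfy `E`. -/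
inductive EdgePath (S : Set G) (E : G → G → Prop) : ℕ → G → G → Prop
  | refl (g : G) : EdgePath S E 0 g g
  | stay {k : ℕ} {g h : G} : EdgePath S E k g h → EdgePath S E (k + 1) g h
  | step {k : ℕ} {g h s : G} : EdgePath S E k g h → s ∈ steps S → E h (h * s) →
      EdgePath S E (k + 1) g (h * s)

namespace EdgePath

variable {S : Set G} {S' : Set G'} {E F : G → G → Prop} {E' : G' → G' → Prop} {k l : ℕ}
  {g h i : G}

theorem mono_length (p : EdgePath S E k g h) (hkl : k ≤ l) : EdgePath S E l g h := by
  induction hkl with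
  | refl => exact p
  | step _ ih => exact ih.stay

theorem refl' (k : ℕ) (g : G) : EdgePath S E k g g := (refl g).mono_length (Nat.zero_le k)

theorem mono (p : EdgePath S E k g h) (hEF : ∀ u v, E u v → F u v) : EdgePath S F k g h := by
  induction p with
  | refl => exact refl _
  | stay _ ih => exact ih.stay
  | step _ hs hE ih => exact ih.step hs (hEF _ _ hE)

theorem trans (p : EdgePath S E k g h) (q : EdgePath S E l h i) : EdgePath S E (k + l) g i := by
  induction q with
  | refl => exact p
  | stay _ ih => exact (ih p).stay
  | step _ hs hE ih => exact (ih p).step hs hE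

theorem single {s : G} (hs : s ∈ steps S) (hE : E g (g * s)) : EdgePath S E 1 g (g * s) :=
  (refl g).step hs hE

theorem symm (hE : ∀ u v, E u v → E v u) (p : EdgePath S E k g h) : EdgePath S E k h g := by
  induction p with
  | refl => exact refl _
  | stay _ ih => exact ih.stay
  | @step k g h s _ hs he ih =>
    have q : EdgePath S E 1 (h * s) (h * s * s⁻¹) :=
      single (inv_mem_steps hs) (by simpa using hE _ _ he)
    rw [mul_inv_cancel_right] at q
    simpa [add_comm] using q.trans ih

theorem map (f : G → G') (hf : ∀ u s, s ∈ steps S → ∃ s' ∈ steps S', f (u * s) = f u * s')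
    (hE : ∀ u v, E u v → E' (f u) (f v)) (p : EdgePath S E k g h) :
    EdgePath S' E' k (f g) (f h) := by
  induction p with
  | refl => exact refl _
  | stay _ ih => exact ih.stay
  | step _ hs he ih =>
    obtain ⟨s', hs', e⟩ := hf _ _ hs
    have := hE _ _ he
    rw [e] at this ⊢
    exact ih.step hs' this

theorem map_hom (f : G →* G') (hf : ∀ s ∈ S, f s ∈ S')
    (hE : ∀ u v, E u v → E' (f u) (f v)) (p : EdgePath S E k g h) :
    EdgePath S' E' k (f g) (f h) :=
  p.map f (fun u s hs => ⟨f s, map_mem_steps f hf hs, map_mul f u s⟩) hE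

theorem mul_left (c : G) (hE : ∀ u v, E u v → F (c * u) (c * v)) (p : EdgePath S E k g h) :
    EdgePath S F k (c * g) (c * h) :=
  p.map (c * ·) (fun u s hs => ⟨s, hs, (mul_assoc c u s).symm⟩) hE

theorem split (k l : ℕ) {g h : G} (p : EdgePath S E (k + l) g h) :
    ∃ v, EdgePath S E k g v ∧ EdgePath S E l v h := by
  induction l generalizing h with
  | zero => exact ⟨h, p, refl h⟩
  | succ l ih =>
    rw [← add_assoc] at p
    cases p with
    | stay q =>
      obtain ⟨v, h₁, h₂⟩ := ih q
      exact ⟨v, h₁, h₂.stay⟩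
    | step q hs he =>
      obtain ⟨v, h₁, h₂⟩ := ih q
      exact ⟨v, h₁, h₂.step hs he⟩

theorem exists_walk (p : EdgePath S E k g h) :
    ∃ w : (cayley S).Walk g h, w.length ≤ k ∧ ∀ d ∈ w.darts, E d.fst d.snd := by
  induction p with
  | refl => exact ⟨.nil, by simp⟩
  | stay _ ih =>
    obtain ⟨w, h₁, h₂⟩ := ih
    exact ⟨w, by lia, h₂⟩
  | @step k g h s _ hs he ih =>
    obtain ⟨w, h₁, h₂⟩ := ih
    -- A generator may be trivial in `G`; the Cayley graph has no loop for it, so the walk stays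
    -- put.
    by_cases hs1 : s = 1
    · subst hs1
      rw [mul_one]
      exact ⟨w, by lia, h₂⟩
    · have hadj : (cayley S).Adj h (h * s) := by
        rw [SimpleGraph.mulCayley_adj']
        refine ⟨by simpa using hs1, ?_⟩
        rcases hs with hs | hs
        · exact ⟨s, hs, Or.inl rfl⟩
        · exact ⟨s⁻¹, hs, Or.inr (by simp)⟩
      refine ⟨w.concat hadj, by simpa using h₁, ?_⟩
      intro d hd
      rw [SimpleGraph.Walk.darts_concat, List.concat_eq_append, List.mem_append] at hd
      rcases hd with hd | hd
      · exact h₂ d hd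
      · rw [List.mem_singleton.1 hd]
        exact he

theorem of_walk (w : (cayley S).Walk g h) : EdgePath S (fun _ _ => True) w.length g h := by
  induction w with
  | nil => exact refl _
  | @cons u v w hadj p ih =>
    have q : EdgePath S (fun _ _ => True) 1 u v := by
      rw [SimpleGraph.mulCayley_adj'] at hadj
      obtain ⟨-, s, hs, rfl | rfl⟩ := hadj
      · exact single (Or.inl hs) trivial
      · have := single (S := S) (E := fun _ _ => True) (g := v * s) (s := s⁻¹)
          (Or.inr (by simpa using hs)) trivial
        simpa using this
    simpa [add_comm] using q.trans ih

end EdgePath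

/-- `WordLE S k g`: the element `g` is a product of at most `k` generators and inverses of
generators from `S`. -/
def WordLE (S : Set G) (k : ℕ) (g : G) : Prop := EdgePath S (fun _ _ => True) k 1 g

theorem EdgePath.wordLE {S : Set G} {E : G → G → Prop} {k : ℕ} {g h : G}
    (p : EdgePath S E k g h) : WordLE S k (g⁻¹ * h) := by
  have := p.mul_left (F := fun _ _ => True) g⁻¹ (fun _ _ _ => trivial)
  simpa [WordLE] using this

namespace WordLE

variable {S : Set G} {S' : Set G'} {k l : ℕ} {g h : G}

theorem edgePath (w : WordLE S k g) (h : G) : EdgePath S (fun _ _ => True) k h (h * g) := by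
  have := EdgePath.mul_left (F := fun _ _ => True) h (fun _ _ _ => trivial) w
  simpa using this

theorem one (S : Set G) (k : ℕ) : WordLE S k 1 := EdgePath.refl' k 1

theorem of_mem {s : G} (hs : s ∈ steps S) : WordLE S 1 s := by
  have := EdgePath.single (S := S) (E := fun _ _ => True) (g := 1) hs trivial
  simpa [WordLE] using this

theorem mul (hg : WordLE S k g) (hh : WordLE S l h) : WordLE S (k + l) (g * h) :=
  EdgePath.trans hg (hh.edgePath g)

theorem mono (hg : WordLE S k g) (hkl : k ≤ l) : WordLE S l g := EdgePath.mono_length hg hkl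

theorem inv (hg : WordLE S k g) : WordLE S k g⁻¹ := by
  simpa using (EdgePath.symm (fun _ _ _ => trivial) hg).wordLE

theorem map (f : G →* G') (hf : ∀ s ∈ S, f s ∈ S') (hg : WordLE S k g) :
    WordLE S' k (f g) := by
  simpa [WordLE] using EdgePath.map_hom (E' := fun _ _ => True) f hf (fun _ _ _ => trivial) hg

theorem split (k l : ℕ) {g : G} (hg : WordLE S (k + l) g) :
    ∃ u v, u * v = g ∧ WordLE S k u ∧ WordLE S l v := by
  obtain ⟨u, h₁, h₂⟩ := EdgePath.split k l hg
  exact ⟨u, u⁻¹ * g, by simp, h₁, h₂.wordLE⟩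

theorem pow (hg : WordLE S k g) (n : ℕ) : WordLE S (n * k) (g ^ n) := by
  induction n with
  | zero => simpa using one S 0
  | succ n ih =>
    rw [pow_succ, Nat.succ_mul]
    exact ih.mul hg

end WordLE

theorem exists_wordLE {S : Set G} (hS : Subgroup.closure S = ⊤) (g : G) : ∃ k, WordLE S k g := by
  have hg : g ∈ Subgroup.closure S := by simp [hS]
  induction hg using Subgroup.closure_induction with
  | mem x hx => exact ⟨1, .of_mem (Or.inl hx)⟩
  | one => exact ⟨0, .one S 0⟩
  | mul x y _ _ hx hy =>
    obtain ⟨k, hk⟩ := hx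
    obtain ⟨l, hl⟩ := hy
    exact ⟨k + l, hk.mul hl⟩
  | inv x _ hx =>
    obtain ⟨k, hk⟩ := hx
    exact ⟨k, hk.inv⟩

theorem wordDist_le_iff {S : Set G} (hS : Subgroup.closure S = ⊤) {g h : G} {k : ℕ} :
    wordDist S g h ≤ k ↔ WordLE S k (g⁻¹ * h) := by
  constructor
  · intro hk
    -- `SimpleGraph.dist` is 0 between unreachable vertices, so reachability is derived from `hS`
    -- before a shortest walk is taken.
    obtain ⟨j, hj⟩ := exists_wordLE hS (g⁻¹ * h)
    have hj' := hj.edgePath g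
    rw [mul_inv_cancel_left] at hj'
    obtain ⟨w, -, -⟩ := hj'.exists_walk
    obtain ⟨p, hp⟩ := w.reachable.exists_walk_length_eq_dist
    have := (EdgePath.of_walk p).wordLE
    rw [hp] at this
    exact this.mono hk
  · intro hk
    have hj' := hk.edgePath g
    rw [mul_inv_cancel_left] at hj'
    obtain ⟨w, hw, -⟩ := hj'.exists_walk
    exact (SimpleGraph.dist_le w).trans hw

theorem wordLength_le_iff {S : Set G} (hS : Subgroup.closure S = ⊤) {g : G} {k : ℕ} :
    wordLength S g ≤ k ↔ WordLE S k g := by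
  rw [wordLength, wordDist_le_iff hS]
  simp

/-- An edge of the Cayley graph lies in the ball of radius `n` as soon as its ends do and one of
them lies in the ball of radius `n - 1`. -/
def EdgeInBall (S : Set G) (n : ℕ) (u v : G) : Prop :=
  WordLE S n u ∧ WordLE S n v ∧ ∃ j, j + 1 = n ∧ (WordLE S j u ∨ WordLE S j v)

theorem EdgeInBall.symm {S : Set G} {n : ℕ} (u v : G) (h : EdgeInBall S n u v) :
    EdgeInBall S n v u := by
  obtain ⟨h₁, h₂, j, hj, h₃⟩ := h
  exact ⟨h₂, h₁, j, hj, h₃.symm⟩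

theorem EdgePath.exists_walk_liesInBall {S : Set G} (hS : Subgroup.closure S = ⊤) {n k : ℕ}
    {g h : G} (hg : WordLE S n g) (p : EdgePath S (EdgeInBall S n) k g h) :
    ∃ w : (cayley S).Walk g h, LiesInBall S n w ∧ w.length ≤ k := by
  obtain ⟨w, hw, hd⟩ := p.exists_walk
  refine ⟨w, ⟨?_, ?_⟩, hw⟩
  · intro v hv
    rw [wordLength_le_iff hS]
    rw [← SimpleGraph.Walk.cons_map_snd_darts, List.mem_cons] at hv
    rcases hv with rfl | hv
    · exact hg
    · obtain ⟨d, hd', rfl⟩ := List.mem_map.1 hv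
      exact (hd d hd').2.1
  · intro d hd' t ht
    obtain ⟨-, -, j, rfl, h | h⟩ := hd d hd'
    · have h' := (wordLength_le_iff hS).2 h
      refine (min_le_left _ _).trans ?_
      have : (wordLength S d.fst : ℝ) ≤ j := by exact_mod_cast h'
      push_cast
      linarith [ht.2]
    · have h' := (wordLength_le_iff hS).2 h
      refine (min_le_right _ _).trans ?_
      have : (wordLength S d.snd : ℝ) ≤ j := by exact_mod_cast h'
      push_cast
      linarith [ht.1]

end EdgePath

/-! ### The Heisenberg group, its symmetries and its balls in closed form -/

/-- The Heisenberg group in symmetric coordinates: `(a, b)` is the abelianisation and `t` is twice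
the signed area swept out by a path ending there. -/
@[ext]
structure Heis where
  a : ℤ
  b : ℤ
  t : ℤ

namespace Heis

instance : Mul Heis := ⟨fun g h => ⟨g.a + h.a, g.b + h.b, g.t + h.t + g.a * h.b - g.b * h.a⟩⟩
instance : One Heis := ⟨⟨0, 0, 0⟩⟩
instance : Inv Heis := ⟨fun g => ⟨-g.a, -g.b, -g.t⟩⟩

@[simp] theorem mul_a (g h : Heis) : (g * h).a = g.a + h.a := rfl
@[simp] theorem mul_b (g h : Heis) : (g * h).b = g.b + h.b := rfl
@[simp] theorem mul_t (g h : Heis) : (g * h).t = g.t + h.t + g.a * h.b - g.b * h.a := rfl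
@[simp] theorem one_a : (1 : Heis).a = 0 := rfl
@[simp] theorem one_b : (1 : Heis).b = 0 := rfl
@[simp] theorem one_t : (1 : Heis).t = 0 := rfl
@[simp] theorem inv_a (g : Heis) : (g⁻¹).a = -g.a := rfl
@[simp] theorem inv_b (g : Heis) : (g⁻¹).b = -g.b := rfl
@[simp] theorem inv_t (g : Heis) : (g⁻¹).t = -g.t := rfl

instance : Group Heis := Group.ofLeftAxioms
  (by intro g h k; ext <;> simp <;> ring)
  (by intro g; ext <;> simp)
  (by intro g; ext <;> simp [mul_comm])

/-- The element `x ^ i`. -/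
def X (i : ℤ) : Heis := ⟨i, 0, 0⟩
/-- The element `y ^ i`. -/
def Y (i : ℤ) : Heis := ⟨0, i, 0⟩

@[simp] theorem X_a (i : ℤ) : (X i).a = i := rfl
@[simp] theorem X_b (i : ℤ) : (X i).b = 0 := rfl
@[simp] theorem X_t (i : ℤ) : (X i).t = 0 := rfl
@[simp] theorem Y_a (i : ℤ) : (Y i).a = 0 := rfl
@[simp] theorem Y_b (i : ℤ) : (Y i).b = i := rfl
@[simp] theorem Y_t (i : ℤ) : (Y i).t = 0 := rfl

theorem X_add (i j : ℤ) : X (i + j) = X i * X j := by ext <;> simp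
theorem Y_add (i j : ℤ) : Y (i + j) = Y i * Y j := by ext <;> simp

/-- The standard generating pair. -/
def gens : Set Heis := {X 1, Y 1}

theorem mem_steps_gens {s : Heis} : s ∈ steps gens ↔ s.t = 0 ∧ |s.a| + |s.b| = 1 := by
  constructor
  · rintro ((rfl | rfl) | (h | h))
    · simp
    · simp
    · rw [inv_eq_iff_eq_inv] at h; subst h; simp
    · rw [Set.mem_singleton_iff, inv_eq_iff_eq_inv] at h; subst h; simp
  · rintro ⟨ht, hab⟩
    rcases s with ⟨a, b, t⟩
    simp only at ht hab
    subst ht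
    have h : (a = 1 ∧ b = 0) ∨ (a = 0 ∧ b = 1) ∨ (a = -1 ∧ b = 0) ∨ (a = 0 ∧ b = -1) := by grind
    rcases h with ⟨rfl, rfl⟩ | ⟨rfl, rfl⟩ | ⟨rfl, rfl⟩ | ⟨rfl, rfl⟩
    · exact Or.inl (Or.inl rfl)
    · exact Or.inl (Or.inr rfl)
    · exact Or.inr (Or.inl rfl)
    · exact Or.inr (Or.inr rfl)

theorem X_one_mem : X 1 ∈ steps gens := by simp [mem_steps_gens]
theorem X_neg_one_mem : X (-1) ∈ steps gens := by simp [mem_steps_gens]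
theorem Y_one_mem : Y 1 ∈ steps gens := by simp [mem_steps_gens]
theorem Y_neg_one_mem : Y (-1) ∈ steps gens := by simp [mem_steps_gens]

/-- The ball of radius `n`, in closed form: a shortest path to `g` runs along the boundary of a
`p × q` box, up to one cut corner. -/
def Ball (n : ℤ) (g : Heis) : Prop :=
  ∃ p q : ℤ, |g.a| ≤ p ∧ |g.b| ≤ q ∧ 2 * (p + q) ≤ n + |g.a| + |g.b| ∧
    |g.t| + |g.a| * |g.b| ≤ 2 * p * q

theorem Ball.mono {n n' : ℤ} {g : Heis} (h : Ball n g) (hn : n ≤ n') : Ball n' g := by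
  obtain ⟨p, q, h₁, h₂, h₃, h₄⟩ := h
  exact ⟨p, q, h₁, h₂, by linarith, h₄⟩

theorem Ball.abs_add_abs_le {n : ℤ} {g : Heis} (h : Ball n g) : |g.a| + |g.b| ≤ n := by
  obtain ⟨p, q, h₁, h₂, h₃, h₄⟩ := h
  linarith

theorem Ball.abs_t_le {n : ℤ} {g : Heis} (h : Ball n g) : |g.t| ≤ n ^ 2 := by
  have h0 := h.abs_add_abs_le
  obtain ⟨p, q, h₁, h₂, h₃, h₄⟩ := h
  have h5 := abs_nonneg g.a
  have h6 := abs_nonneg g.b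
  have h7 : 0 ≤ |g.a| * |g.b| := by positivity
  nlinarith [sq_nonneg (p - q)]

theorem Ball.one {n : ℤ} (hn : 0 ≤ n) : Ball n 1 := ⟨0, 0, by simp, by simp, by simpa, by simp⟩

theorem Ball.inv {n : ℤ} {g : Heis} (h : Ball n g) : Ball n g⁻¹ := by
  obtain ⟨p, q, h⟩ := h
  exact ⟨p, q, by simpa using h⟩

/-- Rotation by a quarter turn. -/
def rot : Heis ≃* Heis where
  toFun g := ⟨-g.b, g.a, g.t⟩
  invFun g := ⟨g.b, -g.a, g.t⟩
  left_inv g := by simp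
  right_inv g := by simp
  map_mul' g h := by
    ext <;> simp <;> ring

/-- Reflection in the diagonal. -/
def swap : Heis ≃* Heis where
  toFun g := ⟨g.b, g.a, -g.t⟩
  invFun g := ⟨g.b, g.a, -g.t⟩
  left_inv g := by simp
  right_inv g := by simp
  map_mul' g h := by
    ext <;> simp
    ring

@[simp] theorem rot_a (g : Heis) : (rot g).a = -g.b := rfl
@[simp] theorem rot_b (g : Heis) : (rot g).b = g.a := rfl
@[simp] theorem rot_t (g : Heis) : (rot g).t = g.t := rfl
@[simp] theorem rot_symm_a (g : Heis) : (rot.symm g).a = g.b := rfl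
@[simp] theorem rot_symm_b (g : Heis) : (rot.symm g).b = -g.a := rfl
@[simp] theorem rot_symm_t (g : Heis) : (rot.symm g).t = g.t := rfl
@[simp] theorem swap_a (g : Heis) : (swap g).a = g.b := rfl
@[simp] theorem swap_b (g : Heis) : (swap g).b = g.a := rfl
@[simp] theorem swap_t (g : Heis) : (swap g).t = -g.t := rfl

/-- Automorphisms permuting the generators and their inverses and preserving the balls. -/
def IsSymmetry (f : Heis ≃* Heis) : Prop :=
  (∀ s, s ∈ steps gens ↔ f s ∈ steps gens) ∧ ∀ n g, Ball n (f g) ↔ Ball n g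

theorem isSymmetry_rot : IsSymmetry rot := by
  constructor
  · intro s
    simp [mem_steps_gens, add_comm]
  · intro n g
    simp only [Ball, rot_a, rot_b, rot_t, abs_neg]
    constructor <;> rintro ⟨p, q, h₁, h₂, h₃, h₄⟩ <;>
      exact ⟨q, p, h₂, h₁, by linarith, by linarith⟩

theorem isSymmetry_swap : IsSymmetry swap := by
  constructor
  · intro s
    simp [mem_steps_gens, add_comm]
  · intro n g
    simp only [Ball, swap_a, swap_b, swap_t, abs_neg]
    constructor <;> rintro ⟨p, q, h₁, h₂, h₃, h₄⟩ <;>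
      exact ⟨q, p, h₂, h₁, by linarith, by linarith⟩

theorem IsSymmetry.symm {f : Heis ≃* Heis} (hf : IsSymmetry f) : IsSymmetry f.symm :=
  ⟨fun s => by rw [hf.1 (f.symm s)]; simp, fun n g => by rw [← hf.2]; simp⟩

theorem IsSymmetry.trans {f f' : Heis ≃* Heis} (hf : IsSymmetry f) (hf' : IsSymmetry f') :
    IsSymmetry (f.trans f') :=
  ⟨fun s => by rw [hf.1, hf'.1]; rfl, fun n g => by
    rw [MulEquiv.trans_apply, hf'.2, hf.2]⟩

theorem Ball.mul_step {n : ℤ} {g s : Heis} (h : Ball n g) (hs : s ∈ steps gens) :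
    Ball (n + 1) (g * s) := by
  -- A step away from the axis widens the box by one; a step towards it keeps the box, since `|a|`
  -- drops as `n` grows.
  have key : ∀ (n : ℤ) (g : Heis), Ball n g → Ball (n + 1) (g * X 1) := by
    rintro n g ⟨p, q, h₁, h₂, h₃, h₄⟩
    have hb := abs_nonneg g.b
    have ht : |g.t - g.b| ≤ |g.t| + |g.b| := abs_sub _ _
    rcases le_or_gt 0 g.a with ha | ha
    · have e : |g.a + 1| = |g.a| + 1 := by rw [abs_of_nonneg ha, abs_of_nonneg]; linarith
      refine ⟨p + 1, q, ?_, ?_, ?_, ?_⟩ <;> simp only [mul_a, mul_b, mul_t, X_a, X_b, X_t, e,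
        add_zero, mul_zero, mul_one]
      · linarith
      · linarith
      · linarith
      · nlinarith
    · have e : |g.a + 1| = |g.a| - 1 := by
        rw [abs_of_neg ha, abs_of_nonpos (by lia)]; ring
      refine ⟨p, q, ?_, ?_, ?_, ?_⟩ <;> simp only [mul_a, mul_b, mul_t, X_a, X_b, X_t, e,
        add_zero, mul_zero, mul_one]
      · linarith
      · linarith
      · linarith
      · nlinarith
  have transfer : ∀ (f : Heis ≃* Heis), IsSymmetry f → f s = X 1 → Ball (n + 1) (g * s) := by
    intro f hf e
    rw [← hf.2, map_mul, e]
    exact key n _ ((hf.2 n g).2 h)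
  rcases hs with (rfl | rfl) | (hs | hs)
  · exact key n g h
  · exact transfer swap isSymmetry_swap (by ext <;> simp)
  · rw [inv_eq_iff_eq_inv] at hs
    subst hs
    exact transfer (rot.trans rot) (isSymmetry_rot.trans isSymmetry_rot) (by ext <;> simp)
  · rw [Set.mem_singleton_iff, inv_eq_iff_eq_inv] at hs
    subst hs
    exact transfer rot isSymmetry_rot (by ext <;> simp)

theorem Ball.mul_wordLE {n : ℤ} {g u : Heis} (h : Ball n g) {k : ℕ} (hu : WordLE gens k u) :
    Ball (n + k) (g * u) := by
  have := hu.edgePath g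
  clear hu
  generalize g * u = g' at this
  induction this with
  | refl => simpa using h
  | stay _ ih => exact (ih h).mono (by simp)
  | step _ hs _ ih => simpa [add_assoc] using (ih h).mul_step hs

theorem ball_of_wordLE {u : Heis} {k : ℕ} (hu : WordLE gens k u) : Ball k u := by
  simpa using (Ball.one le_rfl).mul_wordLE hu

/-- The subgroup generated by `x` and `y` consists of the elements satisfying this parity
condition. -/
def Even (g : Heis) : Prop := g.t % 2 = (g.a * g.b) % 2

theorem Even.mul {g h : Heis} (hg : g.Even) (hh : h.Even) : (g * h).Even := by
  unfold Even at *
  have e : (g * h).t - (g * h).a * (g * h).b =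
      (g.t - g.a * g.b) + (h.t - h.a * h.b) - 2 * (g.b * h.a) := by simp; ring
  lia

theorem Even.inv {g : Heis} (hg : g.Even) : (g⁻¹).Even := by
  unfold Even at *
  simp only [inv_a, inv_b, inv_t, neg_mul_neg]
  lia

theorem Even.of_mem_steps {s : Heis} (hs : s ∈ steps gens) : s.Even := by
  rcases hs with (rfl | rfl) | (hs | hs)
  · simp [Even]
  · simp [Even]
  · rw [inv_eq_iff_eq_inv] at hs; subst hs; simp [Even]
  · rw [Set.mem_singleton_iff, inv_eq_iff_eq_inv] at hs; subst hs; simp [Even]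

theorem Even.rot {g : Heis} (hg : g.Even) : (rot g).Even := by
  unfold Even at *
  simp only [rot_a, rot_b, rot_t, neg_mul, mul_comm g.b g.a]
  lia

theorem Even.swap {g : Heis} (hg : g.Even) : (swap g).Even := by
  unfold Even at *
  simp only [swap_a, swap_b, swap_t, mul_comm g.b g.a]
  lia

/-- Any element can be moved into the first quadrant with nonnegative area by a symmetry. -/
theorem exists_symmetry (g : Heis) : ∃ f : Heis ≃* Heis, IsSymmetry f ∧
    (∀ h : Heis, h.Even → (f h).Even) ∧ 0 ≤ (f g).a ∧ 0 ≤ (f g).b ∧ 0 ≤ (f g).t := by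
  have quad : ∃ f : Heis ≃* Heis, IsSymmetry f ∧ (∀ h : Heis, h.Even → (f h).Even) ∧
      0 ≤ (f g).a ∧ 0 ≤ (f g).b := by
    have r := isSymmetry_rot
    rcases le_total 0 g.a with ha | ha <;> rcases le_total 0 g.b with hb | hb
    · exact ⟨.refl _, ⟨fun _ => Iff.rfl, fun _ _ => Iff.rfl⟩, fun _ h => h, ha, hb⟩
    · exact ⟨rot, r, fun _ h => h.rot, by simpa, by simpa⟩
    · exact ⟨(rot.trans rot).trans rot, (r.trans r).trans r, fun _ h => h.rot.rot.rot,
        by simpa, by simpa⟩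
    · exact ⟨rot.trans rot, r.trans r, fun _ h => h.rot.rot, by simpa, by simpa⟩
  obtain ⟨f, hf, he, ha, hb⟩ := quad
  rcases le_total 0 (f g).t with ht | ht
  · exact ⟨f, hf, he, ha, hb, ht⟩
  · exact ⟨f.trans swap, hf.trans isSymmetry_swap, fun _ h => (he _ h).swap, by simpa, by simpa,
      by simpa⟩

/-- Away from the identity some generator leads closer to it. -/
theorem Ball.exists_descent {n : ℤ} {g : Heis} (h : Ball n g) (hg : g.Even) (h1 : g ≠ 1) :
    ∃ s ∈ steps gens, Ball (n - 1) (g * s) := by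
  have key : ∀ (g : Heis), Ball n g → g.Even → g ≠ 1 → 0 ≤ g.a → 0 ≤ g.b → 0 ≤ g.t →
      ∃ s ∈ steps gens, Ball (n - 1) (g * s) := by
    rintro ⟨a, b, t⟩ ⟨p, q, h₁, h₂, h₃, h₄⟩ he hne ha hb ht
    simp only [Even] at *
    rw [abs_of_nonneg ha] at *
    rw [abs_of_nonneg hb] at *
    rw [abs_of_nonneg ht] at *
    -- Going back along the boundary of the box may lead away from the axis: while `a < p`, the step
    -- `x` keeps the box.
    rcases h₁.lt_or_eq with hp | rfl
    · refine ⟨X 1, X_one_mem, p, q, ?_, ?_, ?_, ?_⟩ <;>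
        simp only [mul_a, mul_b, mul_t, X_a, X_b, X_t, add_zero, mul_zero, mul_one,
          abs_of_nonneg hb, abs_of_nonneg (show 0 ≤ a + 1 by lia)]
      · lia
      · lia
      · lia
      · rcases abs_cases (t - b) with ⟨e, -⟩ | ⟨e, -⟩ <;> rw [e]
        · nlinarith
        · nlinarith
    · rcases hb.lt_or_eq with hb | rfl
      -- With `p = a` the step `y⁻¹` lowers the box by one. This fails only for a box of height one
      -- that the area does not fill. There `x⁻¹` works, because parity improves `t < a` to `t ≤ a -
      -- 2`.
      · by_cases hq : q = 1 ∧ t < a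
        · obtain ⟨rfl, hta⟩ := hq
          obtain rfl : b = 1 := by lia
          refine ⟨X (-1), X_neg_one_mem, a - 1, 1, ?_, ?_, ?_, ?_⟩ <;>
            simp only [mul_a, mul_b, mul_t, X_a, X_b, X_t, add_zero, mul_zero,
              abs_of_nonneg (show 0 ≤ a + -1 by lia), abs_one]
          · lia
          · lia
          · lia
          · rw [abs_of_nonneg (by lia)]
            lia
        · refine ⟨Y (-1), Y_neg_one_mem, a, q - 1, ?_, ?_, ?_, ?_⟩ <;>
            simp only [mul_a, mul_b, mul_t, Y_a, Y_b, Y_t, add_zero, mul_zero,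
              abs_of_nonneg ha, abs_of_nonneg (show 0 ≤ b + -1 by lia)]
          · lia
          · lia
          · lia
          · rcases abs_cases (t + a * -1 - 0) with ⟨e, -⟩ | ⟨e, e'⟩ <;> rw [e]
            · nlinarith
            · have hq2 : 2 ≤ q := by
                by_contra hcon
                exact hq ⟨by lia, by lia⟩
              nlinarith
      · rcases h₂.lt_or_eq with hq | rfl
        · refine ⟨Y (-1), Y_neg_one_mem, a, q, ?_, ?_, ?_, ?_⟩ <;>
            simp only [mul_a, mul_b, mul_t, Y_a, Y_b, Y_t, add_zero, mul_zero,
              abs_of_nonneg ha, zero_add, abs_neg, abs_one]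
          · lia
          · lia
          · lia
          · rcases abs_cases (t + a * -1 - 0) with ⟨e, -⟩ | ⟨e, e'⟩ <;> rw [e]
            · nlinarith
            · nlinarith
        · have ht0 : t = 0 := by linarith
          subst ht0
          have ha0 : a ≠ 0 := by
            rintro rfl
            exact hne rfl
          refine ⟨X (-1), X_neg_one_mem, a - 1, 0, ?_, ?_, ?_, ?_⟩ <;>
            simp only [mul_a, mul_b, mul_t, X_a, X_b, X_t, add_zero, mul_zero,
              abs_of_nonneg (show 0 ≤ a + -1 by lia), abs_zero, zero_mul, sub_zero] <;>
            lia
  obtain ⟨f, hf, he, ha, hb, ht⟩ := exists_symmetry g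
  obtain ⟨s, hs, hB⟩ := key (f g) ((hf.2 n g).2 h) (he g hg) (by simpa using h1) ha hb ht
  refine ⟨f.symm s, (hf.symm.1 s).1 hs, ?_⟩
  rw [← hf.2]
  simpa using hB

/-- Descent to the identity. Parity cannot be dropped: `⟨0, 0, 1⟩` lies in `Ball 4` but not in the
subgroup generated by `gens`. -/
theorem wordLE_of_ball {k : ℕ} {u : Heis} (hB : Ball k u) (he : u.Even) : WordLE gens k u := by
  induction k generalizing u with
  | zero =>
    have h1 := hB.abs_add_abs_le
    have h2 := hB.abs_t_le
    have h3 := abs_nonneg u.a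
    have h4 := abs_nonneg u.b
    simp only [Nat.cast_zero, ne_eq, OfNat.ofNat_ne_zero, not_false_eq_true, zero_pow,
      abs_nonpos_iff] at h1 h2
    have : u = 1 := by
      ext
      · exact abs_eq_zero.1 (by linarith)
      · exact abs_eq_zero.1 (by linarith)
      · exact h2
    rw [this]
    exact .one _ _
  | succ k ih =>
    by_cases h1 : u = 1
    · rw [h1]
      exact .one _ _
    · obtain ⟨s, hs, hB'⟩ := hB.exists_descent he h1
      have := (ih (u := u * s) (by simpa using hB') (he.mul (.of_mem_steps hs))).mul
        (WordLE.of_mem (inv_mem_steps hs))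
      simpa using this

theorem Even.of_wordLE {k : ℕ} {u : Heis} (h : WordLE gens k u) : u.Even := by
  have h1 : (1 : Heis).Even := by simp [Even]
  unfold WordLE at h
  generalize (1 : Heis) = v at h h1
  induction h with
  | refl => exact h1
  | stay _ ih => exact ih h1
  | step _ hs _ ih => exact (ih h1).mul (.of_mem_steps hs)

/-! ### Paths inside balls, and joining points with a common direction of descent -/

/-- `Conn n k g h`: there is a path of length at most `k` from `g` to `h` inside `Ball n`. -/
def Conn (n : ℤ) (k : ℕ) (g h : Heis) : Prop :=
  EdgePath gens (fun u v => Ball n u ∧ Ball n v) k g h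

namespace Conn

variable {n n' : ℤ} {k l : ℕ} {g h i : Heis}

theorem trans (p : Conn n k g h) (q : Conn n l h i) : Conn n (k + l) g i := EdgePath.trans p q

theorem symm (p : Conn n k g h) : Conn n k h g := EdgePath.symm (fun _ _ h => h.symm) p

theorem mono (p : Conn n k g h) (hn : n ≤ n') (hk : k ≤ l) : Conn n' l g h :=
  (EdgePath.mono p fun _ _ h => ⟨h.1.mono hn, h.2.mono hn⟩).mono_length hk

theorem map {f : Heis ≃* Heis} (hf : IsSymmetry f) (p : Conn n k g h) : Conn n k (f g) (f h) :=
  EdgePath.map f (fun u s hs => ⟨f s, (hf.1 s).1 hs, map_mul f u s⟩)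
    (fun u v h => ⟨(hf.2 n u).2 h.1, (hf.2 n v).2 h.2⟩) p

theorem of_map {f : Heis ≃* Heis} (hf : IsSymmetry f) (p : Conn n k (f g) (f h)) :
    Conn n k g h := by
  simpa using p.map hf.symm

theorem even (p : Conn n k g h) (hg : g.Even) : h.Even := by
  simpa using hg.mul (Even.of_wordLE (EdgePath.wordLE p))

/-- One step raises the length by at most one, so `k` steps from depth `k` cannot leave the ball. -/
theorem of_wordLE {u : Heis} (hu : WordLE gens k u) (hg : Ball (n - k) g) :
    Conn n k g (g * u) := by
  have := hu.edgePath g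
  clear hu
  generalize g * u = g' at this
  suffices h : Conn n k g g' ∧ Ball n g' from h.1
  induction this generalizing n with
  | refl => exact ⟨EdgePath.refl _, by simpa using hg⟩
  | stay _ ih =>
    obtain ⟨h₁, h₂⟩ := ih (n := n) (hg.mono (by push_cast; linarith))
    exact ⟨EdgePath.stay h₁, h₂⟩
  | step _ hs _ ih =>
    obtain ⟨h₁, h₂⟩ := ih (n := n - 1) (hg.mono (by push_cast; linarith))
    have h₃ := h₂.mul_step hs
    rw [sub_add_cancel] at h₃
    exact ⟨EdgePath.step (h₁.mono (by linarith) le_rfl) hs ⟨h₂.mono (by linarith), h₃⟩, h₃⟩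

theorem of_seq (f : ℕ → Heis) (r : ℕ) (hs : ∀ i, ∃ s ∈ steps gens, f (i + 1) = f i * s)
    (hB : ∀ i ≤ r, Ball n (f i)) : Conn n r (f 0) (f r) := by
  induction r with
  | zero => exact EdgePath.refl _
  | succ r ih =>
    obtain ⟨s, hs', e⟩ := hs r
    have hr := hB (r + 1) le_rfl
    rw [e] at hr ⊢
    exact EdgePath.step (ih fun i hi => hB i (by lia)) hs' ⟨hB r (by lia), hr⟩

theorem of_X (r : ℕ) (hB : ∀ i : ℤ, 0 ≤ i → i ≤ r → Ball n (g * X i)) :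
    Conn n r g (g * X r) := by
  have := of_seq (n := n) (fun i => g * X i) r
    (fun i => ⟨X 1, X_one_mem, by push_cast; rw [X_add, mul_assoc]⟩)
    (fun i hi => hB i (by lia) (by lia))
  convert this using 1
  ext <;> simp

theorem of_Y (r : ℕ) (hB : ∀ i : ℤ, 0 ≤ i → i ≤ r → Ball n (g * Y i)) :
    Conn n r g (g * Y r) := by
  have := of_seq (n := n) (fun i => g * Y i) r
    (fun i => ⟨Y 1, Y_one_mem, by push_cast; rw [Y_add, mul_assoc]⟩)
    (fun i hi => hB i (by lia) (by lia))
  convert this using 1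
  ext <;> simp

/-- Two points at depth `r` in the ball and at distance at most `2 * r` are joined inside it. -/
theorem of_depth {r : ℕ} (hg : Ball (n - r) g) (hh : Ball (n - r) h)
    (hw : WordLE gens (2 * r) (g⁻¹ * h)) : Conn n (2 * r) g h := by
  rw [two_mul] at hw ⊢
  obtain ⟨u, v, e, hu, hv⟩ := hw.split r r
  have h₁ := of_wordLE hu hg
  have h₂ := of_wordLE hv.inv hh
  have e' : h * v⁻¹ = g * u := by
    rw [mul_inv_eq_iff_eq_mul, mul_assoc, e, mul_inv_cancel_left]
  rw [e'] at h₂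
  exact h₁.trans h₂.symm

end Conn

theorem wordLE_X (k : ℕ) : WordLE gens k (X k) := by
  refine wordLE_of_ball ⟨k, 0, ?_, ?_, ?_, ?_⟩ ?_ <;> simp [Even]
  linarith

theorem ball_of_abs_le {s : ℤ} {g : Heis} (ha : |g.a| ≤ s) (hb : |g.b| ≤ s)
    (ht : |g.t| + |g.a| * |g.b| ≤ 2 * s ^ 2) : Ball (4 * s) g :=
  ⟨s, s, ha, hb, by linarith [abs_nonneg g.a, abs_nonneg g.b], by linarith⟩

/-- Conjugation by `x ^ r` moves an element of length `L` by much less than `r`, for large `r`. -/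
theorem ball_conj_X {L ρ : ℕ} (hρ : 17 * L ≤ ρ) {u : Heis} (hu : WordLE gens L u) :
    Ball (4 * ρ) ((X (16 * ρ))⁻¹ * u * X (16 * ρ)) := by
  have hB := ball_of_wordLE hu
  have h1 := hB.abs_add_abs_le
  have h2 := hB.abs_t_le
  have h3 := abs_nonneg u.a
  have h4 := abs_nonneg u.b
  have hρ' : 17 * (L : ℤ) ≤ ρ := by exact_mod_cast hρ
  have hL : (0 : ℤ) ≤ L := by positivity
  have hab : |u.a| * |u.b| ≤ (L : ℤ) * L := mul_le_mul (by linarith) (by linarith) h4 hL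
  have ht : |u.t - 32 * ρ * u.b| ≤ |u.t| + 32 * ρ * |u.b| := by
    refine (abs_sub _ _).trans_eq ?_
    rw [abs_mul, abs_of_nonneg (by positivity : (0 : ℤ) ≤ 32 * ρ)]
  have hρb : (ρ : ℤ) * |u.b| ≤ ρ * L := mul_le_mul_of_nonneg_left (by linarith) (by positivity)
  have e : (X (16 * ρ))⁻¹ * u * X (16 * ρ) = ⟨u.a, u.b, u.t - 32 * ρ * u.b⟩ := by
    ext <;> simp
    ring
  rw [e]
  -- The central coordinate is at most `L² + 32ρL`, the product of the others at most `L²`. As `17L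
  -- ≤ ρ` and `2 + 32 * 17 ≤ 2 * 17²`, the sum is at most `2ρ²`.
  refine ball_of_abs_le ?_ ?_ ?_
  · simp only; linarith
  · simp only; linarith
  · simp only
    nlinarith

/-- From `g` one can move a distance at most `L` inside `Ball n` and then straight down in
direction `x` for `r` steps. -/
def XReach (L r : ℕ) (n : ℤ) (g : Heis) : Prop :=
  ∃ h, Conn n L g h ∧ ∀ i : ℤ, 0 ≤ i → i ≤ r → Ball (n - i) (h * X i)

/-- From `g` one can move inside `Ball n` to a point at depth `16 * ρ` that is close to
`g * x ^ (16 * ρ)`. -/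
def XGood (ρ K : ℕ) (n : ℤ) (g : Heis) : Prop :=
  ∃ h, Conn n K g h ∧ Ball (n - 16 * ρ) h ∧ Ball (4 * ρ) ((g * X (16 * ρ))⁻¹ * h)

theorem XReach.mono {L L' r : ℕ} {n : ℤ} {g : Heis} (h : XReach L r n g) (hL : L ≤ L') :
    XReach L' r n g := by
  obtain ⟨h, h₁, h₂⟩ := h
  exact ⟨h, h₁.mono le_rfl hL, h₂⟩

theorem XReach.of_conn {K L r : ℕ} {n : ℤ} {g h : Heis} (hc : Conn n K g h)
    (hh : XReach L r n h) : XReach (K + L) r n g := by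
  obtain ⟨i, h₁, h₂⟩ := hh
  exact ⟨i, hc.trans h₁, h₂⟩

/-- The endpoint `h * x ^ (16 * ρ)` differs from `g * x ^ (16 * ρ)` by a conjugate of `g⁻¹ * h`,
which `ball_conj_X` bounds. -/
theorem XReach.xGood {L ρ : ℕ} (hρ : 17 * L ≤ ρ) {n : ℤ} {g : Heis}
    (hg : XReach L (16 * ρ) n g) : XGood ρ (L + 16 * ρ) n g := by
  obtain ⟨h, h₁, h₂⟩ := hg
  refine ⟨h * X (16 * ρ), ?_, ?_, ?_⟩
  · have := Conn.of_X (n := n) (g := h) (16 * ρ) fun i hi hi' => (h₂ i hi hi').mono (by linarith)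
    push_cast at this
    exact h₁.trans this
  · exact h₂ _ (by positivity) (by push_cast; exact le_rfl)
  · have := ball_conj_X hρ (EdgePath.wordLE h₁)
    simpa [mul_assoc] using this

/-- The deep points differ by a product of three elements of length at most `4 * ρ`: the two errors
and the conjugate of `g⁻¹ * g'`. Since `12 * ρ ≤ 2 * (16 * ρ)`, their depth suffices for
`Conn.of_depth`. -/
theorem XGood.conn {ρ K m : ℕ} (hρ : 17 * m ≤ ρ) {n : ℤ} {g g' : Heis} (he : g.Even)
    (hw : WordLE gens m (g⁻¹ * g')) (hg : XGood ρ K n g) (hg' : XGood ρ K n g') :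
    Conn n (2 * K + 32 * ρ) g g' := by
  obtain ⟨h, c, d, b⟩ := hg
  obtain ⟨h', c', d', b'⟩ := hg'
  have he' : g'.Even := by simpa using he.mul (Even.of_wordLE hw)
  have hX : ∀ i : ℤ, (X i).Even := fun i => by simp [Even]
  have w := wordLE_of_ball (k := 4 * ρ) (by push_cast; exact b)
    ((he.mul (hX _)).inv.mul (c.even he))
  have w' := wordLE_of_ball (k := 4 * ρ) (by push_cast; exact b')
    ((he'.mul (hX _)).inv.mul (c'.even he'))
  have v := wordLE_of_ball (k := 4 * ρ) (by push_cast; exact ball_conj_X hρ hw)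
    (((hX _).inv.mul (Even.of_wordLE hw)).mul (hX _))
  have := (w.inv.mul v).mul w'
  have e : h⁻¹ * h' = ((g * X (16 * ρ))⁻¹ * h)⁻¹ * ((X (16 * ρ))⁻¹ * (g⁻¹ * g') * X (16 * ρ)) *
      ((g' * X (16 * ρ))⁻¹ * h') := by group
  rw [← e] at this
  have p := Conn.of_depth (r := 16 * ρ) (by push_cast; exact d) (by push_cast; exact d')
    (this.mono (by lia))
  exact ((c.trans p).trans c'.symm).mono le_rfl (by lia)

/-! ### Where a generator leads down -/

section Descent

variable {n : ℤ} {g : Heis}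

/-- In the first quadrant, `x` leads down as long as there is room in the bounding box. -/
theorem Ball.mul_X (ha : 0 ≤ g.a) (hb : 0 ≤ g.b) (ht : 0 ≤ g.t) (hB : Ball n g) {R : ℤ}
    (h1 : g.a + g.b + 2 * R ≤ n) (h2 : 3 * g.a + 4 * R ≤ n + g.b) {i : ℤ} (hi : 0 ≤ i)
    (hiR : i ≤ R) : Ball (n - i) (g * X i) := by
  rcases g with ⟨a, b, t⟩
  simp only at ha hb ht h1 h2
  -- A narrower box is widened to `a + R` within the half perimeter `σ`. Here `h1` keeps the height
  -- at least `b`, and `h2` gives `2 * (a + R) ≤ σ`, so the box moves towards a square and loses no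
  -- area.
  have box : ∃ p q : ℤ, a + R ≤ p ∧ b ≤ q ∧ 2 * (p + q) ≤ n + a + b ∧ t + a * b ≤ 2 * p * q := by
    obtain ⟨p, q, h₁, h₂, h₃, h₄⟩ := hB
    simp only [abs_of_nonneg ha, abs_of_nonneg hb, abs_of_nonneg ht] at h₁ h₂ h₃ h₄
    rcases le_or_gt (a + R) p with hp | hp
    · exact ⟨p, q, hp, h₂, h₃, h₄⟩
    · obtain ⟨σ, hσ, hσ'⟩ : ∃ σ, 2 * σ ≤ n + a + b ∧ n + a + b < 2 * σ + 2 :=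
        ⟨(n + a + b) / 2, by lia, by lia⟩
      refine ⟨a + R, σ - (a + R), le_rfl, by lia, by lia, ?_⟩
      have hq : q ≤ σ - p := by lia
      have e1 : p * q ≤ p * (σ - p) := mul_le_mul_of_nonneg_left hq (by lia)
      have e2 : 0 ≤ (a + R - p) * (σ - (a + R) - p) := mul_nonneg (by lia) (by lia)
      nlinarith
  obtain ⟨p, q, h₁, h₂, h₃, h₄⟩ := box
  refine ⟨p, q, ?_, ?_, ?_, ?_⟩ <;>
    simp only [mul_a, mul_b, mul_t, X_a, X_b, X_t, add_zero, mul_zero,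
      abs_of_nonneg hb, abs_of_nonneg (show 0 ≤ a + i by lia)]
  · lia
  · lia
  · lia
  · have : (a + i) * b ≤ p * q := mul_le_mul (by lia) h₂ hb (by lia)
    rcases abs_cases (t - b * i) with ⟨e, -⟩ | ⟨e, -⟩ <;> rw [e] <;> nlinarith

/-- In the second quadrant, `y` leads down as long as there is room in the bounding box. -/
theorem Ball.mul_Y (ha : g.a ≤ 0) (hb : 0 ≤ g.b) (ht : 0 ≤ g.t) (hB : Ball n g) {R : ℤ}
    (h1 : -g.a + g.b + 2 * R ≤ n) (h2 : 3 * g.b + 4 * R ≤ n - g.a) {i : ℤ} (hi : 0 ≤ i)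
    (hiR : i ≤ R) : Ball (n - i) (g * Y i) := by
  have hr := isSymmetry_rot.symm
  rw [← hr.2, map_mul]
  have e : rot.symm (Y i) = X i := by ext <;> simp
  rw [e]
  refine Ball.mul_X (R := R) ?_ ?_ ?_ ((hr.2 _ _).2 hB) ?_ ?_ hi hiR <;>
    simp only [rot_symm_a, rot_symm_b, rot_symm_t] <;> lia

/-- From a point of the second quadrant near its boundary with the first, one can reach that
boundary inside the ball. -/
theorem conn_quadrant (ha : g.a ≤ 0) (hb : 0 ≤ g.b) (ht : 0 ≤ g.t) (hB : Ball n g) {k : ℕ}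
    (hk : -g.a ≤ k) (h1 : -g.a + g.b + 2 * k ≤ n) (h2 : 3 * g.b + 4 * k ≤ n - g.a) :
    Conn n (2 * k) g ⟨0, g.b + k, g.t + g.a * (g.b + 2 * k)⟩ ∧
      Ball n ⟨0, g.b + k, g.t + g.a * (g.b + 2 * k)⟩ := by
  have hd : ∀ i : ℤ, 0 ≤ i → i ≤ k → Ball (n - i) (g * Y i) := fun i hi hik =>
    hB.mul_Y ha hb ht h1 h2 hi hik
  have c1 := Conn.of_Y (n := n) (g := g) k fun i hi hik => (hd i hi hik).mono (by linarith)
  obtain ⟨j, hj⟩ := Int.eq_ofNat_of_zero_le (show 0 ≤ -g.a by linarith)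
  have hX : WordLE gens k (X j) := (wordLE_X j).mono (by lia)
  -- The depth `k` gained along `y` pays for at most `k` steps across to the axis.
  have c2 := Conn.of_wordLE (n := n) hX (hd k (by positivity) le_rfl)
  have b2 := (hd k (by positivity) le_rfl).mul_wordLE hX
  rw [sub_add_cancel] at b2
  have e : g * Y k * X j = ⟨0, g.b + k, g.t + g.a * (g.b + 2 * k)⟩ := by
    rw [← hj]
    ext <;> simp
    ring
  rw [e] at c2 b2
  exact ⟨(c1.trans c2).mono le_rfl (by lia), b2⟩

/-- In the second quadrant, without room in direction `y` the bounding box may be taken to be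
not much higher than `b`. -/
theorem Ball.exists_box (ha : g.a ≤ 0) (hb : 0 ≤ g.b) (hB : Ball n g) {R : ℤ} (hR : 0 ≤ R)
    (h : ¬ (-g.a + g.b + 2 * R ≤ n ∧ 3 * g.b + 4 * R ≤ n - g.a)) :
    ∃ p q : ℤ, -g.a ≤ p ∧ g.b ≤ q ∧ q ≤ g.b + R ∧ 2 * (p + q) ≤ n - g.a + g.b ∧
      n - g.a + g.b ≤ 2 * (p + q) + 1 ∧ |g.t| + -g.a * g.b ≤ 2 * p * q := by
  rcases g with ⟨a, b, t⟩
  obtain ⟨p, q, h₁, h₂, h₃, h₄⟩ := hB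
  simp only [abs_of_nonpos ha, abs_of_nonneg hb] at *
  obtain ⟨σ, hσ, hσ'⟩ : ∃ σ, 2 * σ ≤ n - a + b ∧ n - a + b < 2 * σ + 2 :=
    ⟨(n - a + b) / 2, by lia, by lia⟩
  have hp : p ≤ σ - q := by lia
  have e1 : p * q ≤ (σ - q) * q := mul_le_mul_of_nonneg_right hp (by lia)
  rcases le_or_gt q (b + R) with hq | hq
  · exact ⟨σ - q, q, by lia, h₂, hq, by lia, by lia, by nlinarith⟩
  · refine ⟨σ - (b + R), b + R, by lia, by lia, le_rfl, by lia, by lia, ?_⟩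
    -- Now `b + R` lies between the sides `σ - q` and `q`, so taking it as a side, with the same
    -- sum, does not decrease the area.
    have hpb : σ - q ≤ b + R := by
      by_contra hcon
      exact h ⟨by lia, by lia⟩
    have e2 : 0 ≤ (q - (b + R)) * (b + R - (σ - q)) := mul_nonneg (by lia) (by lia)
    nlinarith

/-- In the second quadrant, with a low bounding box of great width, going up to the top of the box
and then in direction `x` leads down all the way. -/
theorem xReach_of_box (ha : g.a ≤ 0) (hb : 0 ≤ g.b) (ht : -(2 * g.t) ≤ -g.a * g.b) {p q : ℤ}
    (h₁ : -g.a ≤ p) (h₂ : g.b ≤ q) (h₃ : 2 * (p + q) ≤ n - g.a + g.b)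
    (h₄ : |g.t| + -g.a * g.b ≤ 2 * p * q) {r L : ℕ} (hq : q ≤ 2 * g.b) (hqL : q ≤ g.b + L)
    (hp : 9 * r ≤ p) : XReach L r n g := by
  obtain ⟨j, hj⟩ := Int.eq_ofNat_of_zero_le (show 0 ≤ q - g.b by linarith)
  obtain ⟨A, hA⟩ : ∃ A, A = -g.a := ⟨_, rfl⟩
  have hAb : 0 ≤ A * g.b := mul_nonneg (by lia) hb
  have ha' : g.a = -A := by lia
  rw [← hA] at h₁ h₄ ht
  have ht4 : g.t + A * g.b ≤ 2 * p * q := by linarith [le_abs_self g.t]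
  have up : ∀ i : ℤ, 0 ≤ i → i ≤ j → Ball (n - i) (g * Y i) := by
    intro i hi hij
    refine ⟨p, q, ?_, ?_, ?_, ?_⟩ <;>
      simp only [mul_a, mul_b, mul_t, Y_a, Y_b, Y_t, add_zero, mul_zero, ha', abs_neg,
        abs_of_nonneg (show 0 ≤ A by lia), abs_of_nonneg (show 0 ≤ g.b + i by lia)]
    · lia
    · lia
    · lia
    · have : A * (g.b + i) ≤ p * q := mul_le_mul h₁ (by lia) (by lia) (by lia)
      rcases abs_cases (g.t + -A * i - 0) with ⟨e, -⟩ | ⟨e, -⟩ <;> rw [e] <;> nlinarith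
  refine ⟨g * Y j, (Conn.of_Y (n := n) j fun i hi hij => (up i hi hij).mono (by lia)).mono le_rfl
    (by lia), ?_⟩
  intro i hi hir
  rcases le_or_gt i A with hiA | hiA
  · refine ⟨p - i, q, ?_, ?_, ?_, ?_⟩ <;>
      simp only [mul_a, mul_b, mul_t, Y_a, Y_b, Y_t, X_a, X_b, X_t, add_zero, mul_zero, ← hj,
        add_sub_cancel, abs_of_nonneg (show 0 ≤ q by lia), ha',
        abs_of_nonpos (show -A + i ≤ 0 by lia)]
    · lia
    · lia
    · lia
    · rcases abs_cases (g.t + -A * (q - g.b) - 0 - q * i) with ⟨e, -⟩ | ⟨e, -⟩ <;> rw [e]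
      · nlinarith
      -- By `ht` the left side is at most `2qA - bA/2`. Either the box protrudes by `r` beyond `A`,
      -- or `A ≥ 8r` and the loss `2rq ≤ 4rb` is covered by `bA/2`.
      · suffices hs : 2 * q * A - g.b * A - g.t ≤ 2 * (p - i) * q by nlinarith
        rcases le_or_gt (A + r) p with hpA | hpA
        · have : A * q ≤ (p - i) * q := mul_le_mul_of_nonneg_right (by lia) (by lia)
          nlinarith
        · have e1 : (A - r) * q ≤ (p - i) * q := mul_le_mul_of_nonneg_right (by lia) (by lia)
          have e2 : 8 * r * g.b ≤ A * g.b := mul_le_mul_of_nonneg_right (by lia) hb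
          have e3 : r * q ≤ r * (2 * g.b) := mul_le_mul_of_nonneg_left hq (by positivity)
          nlinarith
  -- Past the axis only the part of the box on its far side is needed.
  · refine ⟨p - A, q, ?_, ?_, ?_, ?_⟩ <;>
      simp only [mul_a, mul_b, mul_t, Y_a, Y_b, Y_t, X_a, X_b, X_t, add_zero, mul_zero, ← hj,
        add_sub_cancel, abs_of_nonneg (show 0 ≤ q by lia), ha',
        abs_of_nonneg (show 0 ≤ -A + i by lia)]
    · lia
    · lia
    · lia
    · rcases abs_cases (g.t + -A * (q - g.b) - 0 - q * i) with ⟨e, -⟩ | ⟨e, -⟩ <;> rw [e]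
      · nlinarith
      · have e1 : i * q ≤ (p - A) * q := mul_le_mul_of_nonneg_right (by lia) (by lia)
        nlinarith

/-- Direction `x` leads down from points of the upper half plane that are not far to the left of
the first quadrant, if there is enough room in the bounding box. -/
theorem xReach_of_room {k r : ℕ} {R : ℤ} (ha : -k ≤ g.a) (hb : 0 ≤ g.b)
    (ht : k * (g.b + 2 * k) ≤ g.t) (hB : Ball n g) (h1 : |g.a| + g.b + 2 * R ≤ n)
    (h2 : 3 * |g.a| + 4 * R ≤ n + g.b) (hR : 9 * r + 4 * k + 1 ≤ R) : XReach (2 * k) r n g := by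
  have ht0 : 0 ≤ g.t := le_trans (by positivity) ht
  rcases le_or_gt 0 g.a with ha0 | ha0
  · rw [abs_of_nonneg ha0] at h1 h2
    exact ⟨g, EdgePath.refl' _ _, fun i hi hir => hB.mul_X ha0 hb ht0 h1 h2 hi (by lia)⟩
  · rw [abs_of_neg ha0] at h1 h2
    by_cases hroom : -g.a + g.b + 2 * k ≤ n ∧ 3 * g.b + 4 * k ≤ n - g.a
    · obtain ⟨c, b⟩ := conn_quadrant ha0.le hb ht0 hB (k := k) (by lia) hroom.1 hroom.2
      have ht1 : 0 ≤ g.t + g.a * (g.b + 2 * k) := by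
        have : -g.a * (g.b + 2 * k) ≤ k * (g.b + 2 * k) :=
          mul_le_mul_of_nonneg_right (by lia) (by positivity)
        linarith
      refine ⟨_, c, fun i hi hir => b.mul_X (R := r) ?_ ?_ ?_ ?_ ?_ hi hir⟩ <;> simp only <;> lia
    · obtain ⟨p, q, b₁, b₂, b₃, b₄, b₅, b₆⟩ :=
        hB.exists_box ha0.le hb (R := k) (by positivity) hroom
      have : 0 ≤ -g.a * g.b := mul_nonneg (by lia) hb
      exact xReach_of_box ha0.le hb (by lia) b₁ b₂ b₄ b₆ (by lia) (by lia) (by lia)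

end Descent

variable {n : ℤ} {g g' : Heis}

/-- Near the axis `a = b = 0` direction `x` leads down from the left half plane as well. -/
theorem xReach_of_third_quadrant {m r : ℕ} (ha : g.a ≤ 0) (hb : g.b ≤ 0) (ham : -(2 * m) ≤ g.a)
    (hbm : -(4 * m) ≤ g.b) (ht : 200 * (m : ℤ) ^ 2 ≤ g.t) (hB : Ball n g)
    (hn : 36 * r + 200 * m + 4 ≤ n) : XReach (20 * m) r n g := by
  have hr := isSymmetry_rot.symm
  -- A clockwise quarter turn makes this the second quadrant. Turned back, the point reached is on
  -- the negative `a` axis, where `xReach_of_room` applies.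
  have c := conn_quadrant (g := rot.symm g) (k := 4 * m) (n := n) (by simpa) (by simpa)
    (by simp only [rot_symm_t]; nlinarith) ((hr.2 _ _).2 hB) (by simp; lia) (by simp; lia)
    (by simp; lia)
  obtain ⟨c, b⟩ := c
  have c' := c.map isSymmetry_rot
  rw [MulEquiv.apply_symm_apply] at c'
  rw [← isSymmetry_rot.2] at b
  have hm : (0 : ℤ) ≤ m := by positivity
  have := XReach.of_conn c' (xReach_of_room (k := 6 * m) (r := r) (R := 9 * r + 24 * m + 1)
    ?_ ?_ ?_ b ?_ ?_ ?_)
  · exact this.mono (by lia)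
  · simp; lia
  · simp
  · simp only [rot_b, rot_t, rot_symm_a, rot_symm_b, rot_symm_t]
    push_cast
    have : -g.b * (-g.a + 2 * (4 * m)) ≤ 4 * m * (10 * m) :=
      mul_le_mul (by lia) (by lia) (by lia) (by lia)
    nlinarith
  · simp only [rot_a, rot_b, rot_symm_b, abs_neg]
    push_cast
    rw [abs_of_nonneg (by lia)]
    lia
  · simp only [rot_a, rot_b, rot_symm_b, abs_neg]
    push_cast
    rw [abs_of_nonneg (by lia)]
    lia
  · push_cast
    lia

/-- Near the axis `a = b = 0` direction `x` leads down from everywhere. -/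
theorem xReach_of_axis {m r : ℕ} (ha : |g.a| ≤ 2 * m) (hb : |g.b| ≤ 2 * m)
    (ht : 300 * (m : ℤ) ^ 2 ≤ g.t) (hB : Ball n g)
    (hn : 36 * r + 200 * m + 4 ≤ n) : XReach (24 * m) r n g := by
  rw [abs_le] at ha hb
  have hm : (0 : ℤ) ≤ m := by positivity
  rcases le_or_gt 0 g.b with hb0 | hb0
  · refine (xReach_of_room (k := 2 * m) (r := r) (R := 9 * r + 8 * m + 1)
      ?_ hb0 ?_ hB ?_ ?_ ?_).mono (by lia)
    · push_cast; lia
    · push_cast; nlinarith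
    · have : |g.a| ≤ 2 * m := abs_le.2 ha
      lia
    · have : |g.a| ≤ 2 * m := abs_le.2 ha
      lia
    · push_cast; lia
  · rcases le_or_gt g.a 0 with ha0 | ha0
    · exact (xReach_of_third_quadrant ha0 hb0.le ha.1 (by lia) (by nlinarith) hB hn).mono (by lia)
    -- From the fourth quadrant one first crosses into the third; a half turn makes this a crossing
    -- from the second to the first.
    · have hr := isSymmetry_rot.trans isSymmetry_rot
      obtain ⟨c, b⟩ := conn_quadrant (g := (rot.trans rot) g) (k := 2 * m) (n := n) (by simp; lia)
        (by simp; lia) (by simp only [MulEquiv.trans_apply, rot_t]; nlinarith) ((hr.2 _ _).2 hB)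
        (by simp; lia) (by simp; lia) (by simp; lia)
      have c' := c.map hr.symm
      rw [MulEquiv.symm_apply_apply] at c'
      rw [← hr.symm.2] at b
      refine (XReach.of_conn c' (xReach_of_third_quadrant (m := m) (r := r)
        ?_ ?_ ?_ ?_ ?_ b hn)).mono (by lia)
      · simp
      · simp; lia
      · simp
      · simp; lia
      · simp only [MulEquiv.trans_apply, MulEquiv.symm_trans_apply, rot_a, rot_b, rot_t,
          rot_symm_t]
        push_cast
        have : g.a * (-g.b + 2 * (2 * m)) ≤ 2 * m * (6 * m) :=
          mul_le_mul (by lia) (by lia) (by lia) (by lia)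
        nlinarith

/-- If almost all of the length of `g` is accounted for by its first coordinate, then any geodesic
to the identity runs mostly in one direction. -/
theorem xGood_of_thin {D ρ : ℕ} (hρ : 25 * D ≤ ρ) (he : g.Even) (hB : Ball n g)
    (hn : n ≤ -g.a + D) (hn' : 16 * ρ ≤ n) : XGood ρ (16 * ρ) n g := by
  obtain ⟨N, rfl⟩ := Int.eq_ofNat_of_zero_le (show 0 ≤ n by lia)
  obtain ⟨M, rfl⟩ := Nat.exists_eq_add_of_le (show 16 * ρ ≤ N by lia)
  -- The first `16 * ρ` letters `u` of a word of length `n` from `g` to the identity lead to depth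
  -- `16 * ρ`.
  obtain ⟨u, v, e, hu, hv⟩ := (wordLE_of_ball hB he).inv.split (16 * ρ) M
  have e' : g * u = v⁻¹ := by
    rw [eq_inv_iff_mul_eq_one, mul_assoc, e, mul_inv_cancel]
  have hd : Ball M (g * u) := by
    rw [e']
    exact ball_of_wordLE hv.inv
  refine ⟨g * u, ?_, hd.mono (by push_cast; lia), ?_⟩
  · have := Conn.of_wordLE (n := (16 * ρ + M : ℕ)) hu.inv (hd.mono (by push_cast; lia))
    rw [mul_inv_cancel_right] at this
    exact this.symm
  · have hd1 := hd.abs_add_abs_le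
    have hB := ball_of_wordLE hu
    have hu1 := hB.abs_add_abs_le
    obtain ⟨p, q, h₁, h₂, h₃, h₄⟩ := hB
    simp only [mul_a, mul_b] at hd1
    push_cast at hn hu1 h₃
    have b1 := neg_abs_le (g.a + u.a)
    have b2 := abs_nonneg (g.b + u.b)
    have b3 := le_abs_self u.a
    have b4 := abs_nonneg u.b
    have b5 := abs_nonneg u.a
    have hD : (0 : ℤ) ≤ D := by positivity
    have hρ' : 25 * (D : ℤ) ≤ ρ := by exact_mod_cast hρ
    -- Little length is left for sideways motion, so `u` has a box of height at most `D`. The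
    -- central error is at most `48ρD`, and `25 * D ≤ ρ` keeps it below `2ρ²` with room for `D²`.
    have hq : q ≤ D := by lia
    have hp : p ≤ 16 * ρ := by lia
    have hpq : p * q ≤ 16 * ρ * D := mul_le_mul hp hq (by lia) (by lia)
    have hab : 0 ≤ |u.a| * |u.b| := by positivity
    have hub : (ρ : ℤ) * |u.b| ≤ ρ * D := mul_le_mul_of_nonneg_left (by lia) (by lia)
    have ht : |u.t - 16 * ρ * u.b| ≤ |u.t| + 16 * ρ * |u.b| := by
      refine (abs_sub _ _).trans_eq ?_
      rw [abs_mul, abs_of_nonneg (by positivity : (0 : ℤ) ≤ 16 * ρ)]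
    have e2 : (g * X (16 * ρ))⁻¹ * (g * u) = ⟨u.a - 16 * ρ, u.b, u.t - 16 * ρ * u.b⟩ := by
      rw [mul_inv_rev, mul_assoc, inv_mul_cancel_left]
      ext <;> simp <;> ring
    have ha' : |u.a - 16 * ρ| ≤ D := abs_le.2 ⟨by lia, by lia⟩
    rw [e2]
    refine ball_of_abs_le ?_ ?_ ?_ <;> simp only
    · lia
    · lia
    · have : |u.a - 16 * ρ| * |u.b| ≤ D * D := mul_le_mul ha' (by lia) b4 hD
      nlinarith

/-! ### Case analysis for two nearby points of a ball -/

/-- An element of minimal length with room in its bounding box has large area. -/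
theorem lt_t_of_room {M R : ℤ} (hM : 0 ≤ M) (hMR : M + 1 ≤ R) (ha : 0 ≤ g.a) (hb : 0 ≤ g.b)
    (hB' : ¬ Ball (n - 1) g) (ht : 0 ≤ g.t) (h1 : g.a + g.b + 2 * R ≤ n)
    (h2 : 3 * g.a + 4 * R ≤ n + g.b ∨ 2 * M ≤ g.a) : M * (g.a + g.b) + M ^ 2 < g.t := by
  rcases g with ⟨a, b, t⟩
  simp only at ha hb ht h1 h2 ⊢
  by_contra! hcon
  apply hB'
  obtain ⟨p, q, hp, hq, hpq, H⟩ : ∃ p q : ℤ, a ≤ p ∧ b ≤ q ∧ 2 * (p + q) ≤ n - 1 + a + b ∧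
      M * (a + b) + M ^ 2 + a * b ≤ 2 * p * q := by
    obtain ⟨σ, hσ, hσ'⟩ : ∃ σ, 2 * σ ≤ n - 1 + a + b ∧ n - 1 + a + b < 2 * σ + 2 :=
      ⟨(n - 1 + a + b) / 2, by lia, by lia⟩
    -- With room beside `g` the box takes width `a + R - 1`; with `a` large it keeps width `a`, and
    -- the spare height, at least `M`, supplies the area.
    rcases h2 with h2 | h2
    · refine ⟨a + R - 1, σ - (a + R - 1), by lia, by lia, by lia, ?_⟩
      obtain ⟨q, hq⟩ : ∃ q, q = σ - (a + R - 1) := ⟨_, rfl⟩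
      rw [← hq]
      have e1 : a * b ≤ a * q := mul_le_mul_of_nonneg_left (by lia) ha
      have e2 : 0 ≤ a * q := mul_nonneg ha (by lia)
      have e3 : M * (2 * q) ≤ (R - 1) * (2 * q) := mul_le_mul_of_nonneg_right (by lia) (by lia)
      have e4 : M * (a + b + M) ≤ M * (2 * q) := mul_le_mul_of_nonneg_left (by lia) hM
      nlinarith
    · refine ⟨a, σ - a, le_rfl, by lia, by lia, ?_⟩
      have e1 : a * (b + M) ≤ a * (σ - a) := mul_le_mul_of_nonneg_left (by lia) ha
      have e2 : 2 * M * b ≤ a * b := mul_le_mul_of_nonneg_right h2 hb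
      have e3 : 2 * M * M ≤ a * M := mul_le_mul_of_nonneg_right h2 hM
      have e4 : 0 ≤ M * b := mul_nonneg hM hb
      have e5 : 0 ≤ M * M := mul_nonneg hM hM
      nlinarith
  refine ⟨p, q, ?_, ?_, ?_, ?_⟩ <;>
    simp only [abs_of_nonneg ha, abs_of_nonneg hb, abs_of_nonneg ht] <;> linarith

/-- How far the coordinates of an element can change over a distance `m`. -/
theorem coords_of_wordLE {m : ℕ} (ha : 0 ≤ g.a) (hb : 0 ≤ g.b) (hw : WordLE gens m (g⁻¹ * g')) :
    |g'.a - g.a| + |g'.b - g.b| ≤ m ∧ g.t - m * (g.a + g.b) - m ^ 2 ≤ g'.t := by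
  have hB := ball_of_wordLE hw
  have h1 := hB.abs_add_abs_le
  have h2 := hB.abs_t_le
  obtain ⟨w, hw'⟩ : ∃ w, w = g⁻¹ * g' := ⟨_, rfl⟩
  obtain rfl : g' = g * w := by rw [hw']; simp
  rw [← hw'] at h1 h2
  constructor
  · simpa using h1
  · simp only [mul_t]
    have b1 := neg_abs_le w.t
    have b2 : -(m : ℤ) ≤ w.b := by linarith [neg_abs_le w.b, abs_nonneg w.a]
    have b3 : w.a ≤ m := by linarith [le_abs_self w.a, abs_nonneg w.b]
    have := mul_le_mul_of_nonneg_left b2 ha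
    have := mul_le_mul_of_nonneg_left b3 hb
    nlinarith

theorem IsSymmetry.wordLE {f : Heis ≃* Heis} (hf : IsSymmetry f) {k : ℕ} {u : Heis}
    (hu : WordLE gens k u) : WordLE gens k (f u) := by
  have := EdgePath.map (E' := fun _ _ => True) f
    (fun u s hs => ⟨f s, (hf.1 s).1 hs, map_mul f u s⟩) (fun _ _ _ => trivial) hu
  rwa [map_one] at this

/-- Points from which, up to a symmetry, the same direction leads down are joined in the ball. -/
theorem IsSymmetry.conn_of_xGood {f : Heis ≃* Heis} (hf : IsSymmetry f) {ρ K m : ℕ}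
    (hρ : 17 * m ≤ ρ) (he : (f g).Even) (hw : WordLE gens m (g⁻¹ * g')) (hg : XGood ρ K n (f g))
    (hg' : XGood ρ K n (f g')) : Conn n (2 * K + 32 * ρ) g g' := by
  have hw' := hf.wordLE hw
  rw [map_mul, map_inv] at hw'
  exact Conn.of_map hf (XGood.conn (hg' := hg') hρ he hw' hg)

/-- The case of a spacious bounding box. -/
theorem conn_of_room {m : ℕ} (he : g.Even) (ha : 0 ≤ g.a) (hb : 0 ≤ g.b)
    (ht : 0 ≤ g.t) (hB : Ball n g) (hB' : ¬ Ball (n - 1) g) (hg' : Ball n g')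
    (hw : WordLE gens m (g⁻¹ * g')) (hm : 1 ≤ m) (h1 : g.a + g.b + 2 * (60002 * m) ≤ n)
    (h2 : 3 * g.a + 4 * (60002 * m) ≤ n + g.b) (hn : 300000 * m ≤ n) :
    Conn n (30000 * m) g g' := by
  obtain ⟨hab, ht'⟩ := coords_of_wordLE ha hb hw
  -- The area lost on the way to `g'` is at most `m(a + b) + m²`, so `M = 100 * m` leaves both
  -- points enough area for the descent lemmas.
  have hT := lt_t_of_room (M := 100 * m) (R := 60002 * m) (by positivity) (by lia) ha hb hB' ht
    h1 (Or.inl h2)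
  have hm' : (0 : ℤ) ≤ m := by positivity
  have ea : |g'.a - g.a| ≤ m := by linarith [abs_nonneg (g'.b - g.b)]
  have eb : |g'.b - g.b| ≤ m := by linarith [abs_nonneg (g'.a - g.a)]
  rw [abs_le] at ea eb
  have hma : 0 ≤ m * g.a := mul_nonneg hm' ha
  have hmb : 0 ≤ m * g.b := mul_nonneg hm' hb
  have hmm : (m : ℤ) * 1 ≤ m * m := mul_le_mul_of_nonneg_left (by exact_mod_cast hm) hm'
  have hma' : m * g'.a ≤ m * (g.a + m) := mul_le_mul_of_nonneg_left (by linarith) hm'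
  have hmb' : m * g'.b ≤ m * (g.b + m) := mul_le_mul_of_nonneg_left (by linarith) hm'
  have fin : ∀ f : Heis ≃* Heis, IsSymmetry f → (f g).Even →
      XReach (24 * m) (16 * (408 * m)) n (f g) → XReach (24 * m) (16 * (408 * m)) n (f g') →
      Conn n (30000 * m) g g' := fun f hf hfe x x' =>
    (hf.conn_of_xGood (by lia) hfe hw (x.xGood (by lia)) (x'.xGood (by lia))).mono le_rfl (by lia)
  rcases le_or_gt (m : ℤ) g.b with hbm | hbm
  · refine fin (.refl _) ⟨fun _ => Iff.rfl, fun _ _ => Iff.rfl⟩ he ?_ ?_ <;>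
      simp only [MulEquiv.refl_apply]
    · refine (xReach_of_room (k := m) (R := 60002 * m) (by lia) hb ?_ hB ?_ ?_ ?_).mono (by lia)
      · nlinarith
      · rwa [abs_of_nonneg ha]
      · rwa [abs_of_nonneg ha]
      · push_cast; lia
    · refine (xReach_of_room (k := m) (R := 60001 * m) (by lia) (by lia) ?_ hg' ?_ ?_ ?_).mono
        (by lia)
      · nlinarith
      · have : |g'.a| ≤ g.a + m := abs_le.2 ⟨by lia, by lia⟩
        lia
      · have : |g'.a| ≤ g.a + m := abs_le.2 ⟨by lia, by lia⟩
        lia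
      · push_cast; lia
  -- Here `g'` may lie below the `a` axis. If `a` is not small, a quarter turn puts both points in
  -- the upper half plane, close to the `b` axis.
  · rcases le_or_gt (m : ℤ) g.a with ham | ham
    · refine fin rot isSymmetry_rot he.rot ?_ ?_
      · refine (xReach_of_room (k := 2 * m) (R := 60001 * m) ?_ ha ?_
          ((isSymmetry_rot.2 _ _).2 hB) ?_ ?_ (by push_cast; lia)).mono (by lia) <;>
          simp only [rot_a, rot_b, rot_t, abs_neg, abs_of_nonneg hb] <;> push_cast
        · lia
        · nlinarith
        · lia
        · lia
      · have : |g'.b| ≤ 2 * m := abs_le.2 ⟨by lia, by lia⟩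
        refine (xReach_of_room (k := 2 * m) (R := 60000 * m) ?_ ?_ ?_
          ((isSymmetry_rot.2 _ _).2 hg') ?_ ?_ (by push_cast; lia)).mono (by lia) <;>
          simp only [rot_a, rot_b, rot_t, abs_neg] <;> push_cast
        · lia
        · lia
        · nlinarith
        · lia
        · lia
    · refine fin (.refl _) ⟨fun _ => Iff.rfl, fun _ _ => Iff.rfl⟩ he ?_ ?_ <;>
        simp only [MulEquiv.refl_apply]
      · refine xReach_of_axis (m := m) ?_ ?_ ?_ hB ?_
        · rw [abs_of_nonneg ha]; lia
        · rw [abs_of_nonneg hb]; lia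
        · nlinarith
        · push_cast; lia
      · refine xReach_of_axis (m := m) (abs_le.2 ⟨by lia, by lia⟩) (abs_le.2 ⟨by lia, by lia⟩)
          ?_ hg' ?_
        · nlinarith
        · push_cast; lia

/-- The case of a bounding box whose right side is close to `g`, but which is neither low nor
narrow. -/
theorem conn_of_box {m : ℕ} (he : g.Even) (ha : 0 ≤ g.a) (hb : 0 ≤ g.b)
    (ht : 0 ≤ g.t) (hB : Ball n g) (hB' : ¬ Ball (n - 1) g) (hg' : Ball n g')
    (hw : WordLE gens m (g⁻¹ * g')) (hm : 1 ≤ m)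
    (h : ¬ (g.a + g.b + 2 * (60002 * m) ≤ n ∧ 3 * g.a + 4 * (60002 * m) ≤ n + g.b))
    (ha' : g.a + 400000000 * m < n) (hb' : g.b + 400000000 * m < n) :
    Conn n (100000000 * m) g g' := by
  obtain ⟨hab, ht'⟩ := coords_of_wordLE ha hb hw
  have hm' : (1 : ℤ) ≤ m := by exact_mod_cast hm
  have ea : |g'.a - g.a| ≤ m := by linarith [abs_nonneg (g'.b - g.b)]
  have eb : |g'.b - g.b| ≤ m := by linarith [abs_nonneg (g'.a - g.a)]
  rw [abs_le] at ea eb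
  have ham : 1000000 * m ≤ g.a := by
    by_contra hcon
    exact h ⟨by lia, by lia⟩
  -- Near the `a` axis minimality makes the area of `g` large, so that of `g'` stays nonnegative.
  -- Farther up, a slightly negative area is harmless to `xReach_of_box`.
  have hT : g.b < 10 * m → 0 ≤ g'.t := by
    intro hb10
    have := lt_t_of_room (M := 100 * m) (R := 100 * m + 1) (by positivity) (by lia) ha hb hB' ht
      (by lia) (Or.inr (by lia))
    nlinarith
  have fin : XReach (60003 * m) (16 * (1020051 * m)) n (rot g) →
      XReach (60003 * m) (16 * (1020051 * m)) n (rot g') →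
      Conn n (100000000 * m) g g' := fun x x' =>
    (isSymmetry_rot.conn_of_xGood (by lia) he.rot hw (x.xGood (by lia)) (x'.xGood (by lia))).mono
      le_rfl (by lia)
  have main : ∀ k : Heis, Ball n k → g.a - m ≤ k.a → k.a ≤ g.a + m → g.b - m ≤ k.b →
      k.b ≤ g.b + m → 0 ≤ k.b → -(2 * k.t) ≤ k.b * k.a →
      XReach (60003 * m) (16 * (1020051 * m)) n (rot k) := by
    intro k hk k1 k2 k3 k4 k5 k6
    -- The quarter turn converts missing room on the right into missing room above, so the top of
    -- the box is close.
    obtain ⟨p, q, b₁, b₂, b₃, b₄, b₅, b₆⟩ := ((isSymmetry_rot.2 _ _).2 hk).exists_box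
      (R := 60003 * m) (by simpa) (by simp; lia) (by positivity) (by
        simp only [rot_a, rot_b]
        intro h'
        exact h ⟨by lia, by lia⟩)
    simp only [rot_a, rot_b, rot_t, neg_neg] at b₁ b₂ b₃ b₄ b₅ b₆
    refine xReach_of_box (p := p) (q := q) ?_ ?_ ?_ ?_ ?_ ?_ ?_ ?_ ?_
      (by push_cast; lia) <;>
      simp only [rot_a, rot_b, rot_t, neg_neg] <;> push_cast <;> lia
  refine fin (main g hB (by lia) (by lia) (by lia) (by lia) hb ?_) ?_
  · have := mul_nonneg hb ha
    lia
  · rcases le_or_gt 0 g'.b with hb0 | hb0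
    · refine main g' hg' (by lia) (by lia) (by lia) (by lia) hb0 ?_
      rcases lt_or_ge g.b (10 * m) with hb10 | hb10
      · have := hT hb10
        have : 0 ≤ g'.b * g'.a := mul_nonneg hb0 (by lia)
        lia
      · have e1 : (g.b - m) * (g.a - m) ≤ g'.b * g'.a :=
          mul_le_mul (by lia) (by lia) (by lia) (by lia)
        have e2 : 10 * m * g.a ≤ g.b * g.a := mul_le_mul_of_nonneg_right hb10 ha
        have e3 : 10 * m * g.b ≤ g.a * g.b := mul_le_mul_of_nonneg_right (by lia) hb
        nlinarith
    -- Below the `a` axis the turned point is already in the first quadrant, and `ha'` gives room to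
    -- descend at once.
    · refine ⟨rot g', EdgePath.refl' _ _, fun i hi hir =>
        ((isSymmetry_rot.2 _ _).2 hg').mul_X (R := 16321000 * m) ?_ ?_ ?_ ?_ ?_ hi ?_⟩
      · simp; lia
      · simp; lia
      · exact hT (by lia)
      · simp; lia
      · simp; lia
      · push_cast at hir; lia

/-- Points at bounded distance in a ball are joined by a path of bounded length in the ball. -/
theorem exists_conn (m : ℕ) : ∃ K : ℕ, ∀ (n : ℤ) (g g' : Heis), g.Even → Ball n g →
    ¬ Ball (n - 1) g → Ball n g' → WordLE gens m (g⁻¹ * g') → Conn n K g g' := by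
  suffices H : ∀ m : ℕ, 1 ≤ m → ∀ (n : ℤ) (g g' : Heis), g.Even → 0 ≤ g.a → 0 ≤ g.b → 0 ≤ g.t →
      Ball n g → ¬ Ball (n - 1) g → Ball n g' → WordLE gens m (g⁻¹ * g') →
      Conn n (1000000000000 * m) g g' by
    refine ⟨1000000000000 * (m + 1), fun n g g' he hB hB' hg' hw => ?_⟩
    obtain ⟨f, hf, hfe, ha, hb, ht⟩ := exists_symmetry g
    refine Conn.of_map hf (H (m + 1) (by lia) n (f g) (f g') (hfe g he) ha hb ht
      ((hf.2 _ _).2 hB) (by rwa [hf.2]) ((hf.2 _ _).2 hg') ?_)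
    rw [← map_inv, ← map_mul]
    exact hf.wordLE (hw.mono (by lia))
  intro m hm n g g' he ha hb ht hB hB' hg' hw
  have he' : g'.Even := by simpa using he.mul (Even.of_wordLE hw)
  -- Above this bound the `16 * ρ` steps of the thin case fit, with `ρ = 25 * D` and `D = 400000001
  -- * m`: the slack of `g` plus `m` for `g'`. Below it the path passes through the identity.
  rcases le_or_gt n (400 * 400000001 * m) with hn | hn
  · have hn0 : 0 ≤ n := by linarith [hB.abs_add_abs_le, abs_nonneg g.a, abs_nonneg g.b]
    obtain ⟨N, rfl⟩ := Int.eq_ofNat_of_zero_le hn0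
    have c := Conn.of_wordLE (n := N) (wordLE_of_ball hB he) (Ball.one (by simp))
    have c' := Conn.of_wordLE (n := N) (wordLE_of_ball hg' he') (Ball.one (by simp))
    rw [one_mul] at c c'
    exact (c.symm.trans c').mono le_rfl (by lia)
  · obtain ⟨hab, ht'⟩ := coords_of_wordLE ha hb hw
    have ea : |g'.a - g.a| ≤ m := by linarith [abs_nonneg (g'.b - g.b)]
    have eb : |g'.b - g.b| ≤ m := by linarith [abs_nonneg (g'.a - g.a)]
    rw [abs_le] at ea eb
    have thin : ∀ f : Heis ≃* Heis, IsSymmetry f → (f g).Even → (f g').Even →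
        n ≤ -(f g).a + 400000000 * m → -(f g).a - m ≤ -(f g').a →
        Conn n (1000000000000 * m) g g' := fun f hf h₁ h₂ h₃ h₄ =>
      (hf.conn_of_xGood (ρ := 25 * (400000001 * m)) (by lia) h₁ hw
        (xGood_of_thin (D := 400000001 * m) le_rfl h₁ ((hf.2 _ _).2 hB) (by push_cast; lia)
          (by push_cast; lia))
        (xGood_of_thin (D := 400000001 * m) le_rfl h₂ ((hf.2 _ _).2 hg') (by push_cast; lia)
          (by push_cast; lia))).mono le_rfl (by lia)
    rcases le_or_gt n (g.a + 400000000 * m) with hna | hna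
    · exact thin (rot.trans rot) (isSymmetry_rot.trans isSymmetry_rot) he.rot.rot he'.rot.rot
        (by simpa) (by simp; lia)
    rcases le_or_gt n (g.b + 400000000 * m) with hnb | hnb
    · exact thin rot isSymmetry_rot he.rot he'.rot (by simpa) (by simp; lia)
    by_cases h : g.a + g.b + 2 * (60002 * m) ≤ n ∧ 3 * g.a + 4 * (60002 * m) ≤ n + g.b
    · exact (conn_of_room he ha hb ht hB hB' hg' hw hm h.1 h.2 (by lia)).mono le_rfl (by lia)
    · exact (conn_of_box he ha hb ht hB hB' hg' hw hm h hna hnb).mono le_rfl (by lia)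

end Heis

open scoped commutatorElement

/-! ### Transfer of paths along homomorphisms -/

section Lift

variable {G : Type*} [Group G] {G' : Type*} [Group G']

/-- Paths found in coordinates return to `N` this way; injectivity of `coordN` then identifies the
endpoint. -/
theorem EdgePath.lift {S : Set G} {S' : Set G'} {E : G → G → Prop} {E' : G' → G' → Prop}
    (f : G →* G') (hf : ∀ s' ∈ S', ∃ s ∈ S, f s = s')
    (hE : ∀ u s, s ∈ steps S → E' (f u) (f (u * s)) → E u (u * s)) {k : ℕ} {g : G} {h' : G'}
    (p : EdgePath S' E' k (f g) h') : ∃ h, f h = h' ∧ EdgePath S E k g h := by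
  generalize hg' : f g = g' at p
  induction p with
  | refl => exact ⟨g, hg', .refl g⟩
  | stay _ ih =>
    obtain ⟨h, h₁, h₂⟩ := ih hg'
    exact ⟨h, h₁, h₂.stay⟩
  | step _ hs he ih =>
    obtain ⟨h, rfl, h₂⟩ := ih hg'
    obtain ⟨s, hs', rfl⟩ : ∃ s ∈ steps S, f s = _ := by
      rcases hs with hs | hs
      · obtain ⟨s, h, e⟩ := hf _ hs
        exact ⟨s, Or.inl h, e⟩
      · obtain ⟨s, h, e⟩ := hf _ hs
        exact ⟨s⁻¹, Or.inr (by simpa using h), by simp [e]⟩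
    rw [← map_mul] at he ⊢
    exact ⟨h * s, rfl, h₂.step hs' (hE _ _ hs' he)⟩

theorem EdgeInBall.mono {S : Set G} {n n' : ℕ} (hn : n ≤ n') {u v : G} (h : EdgeInBall S n u v) :
    EdgeInBall S n' u v := by
  obtain ⟨h₁, h₂, j, rfl, h₃⟩ := h
  refine ⟨h₁.mono hn, h₂.mono hn, n' - 1, by lia, ?_⟩
  exact h₃.imp (fun h => h.mono (by lia)) (fun h => h.mono (by lia))

theorem EdgeInBall.map {S : Set G} {S' : Set G'} (f : G →* G') (hf : ∀ s ∈ S, f s ∈ S') {n : ℕ}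
    {u v : G} (h : EdgeInBall S n u v) : EdgeInBall S' n (f u) (f v) := by
  obtain ⟨h₁, h₂, j, hj, h₃⟩ := h
  exact ⟨h₁.map f hf, h₂.map f hf, j, hj, h₃.imp (fun h => h.map f hf) (fun h => h.map f hf)⟩

/-- Along the powers of a generator the length grows by at most one at each step. -/
theorem edgePath_pow {S : Set G} {s : G} (hs : s ∈ steps S) {j n : ℕ} {u : G} (hu : WordLE S j u)
    (i : ℕ) (hi : j + i ≤ n) : EdgePath S (EdgeInBall S n) i u (u * s ^ i) := by
  have hw : ∀ i, WordLE S (j + i) (u * s ^ i) := fun i => by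
    simpa using hu.mul ((WordLE.of_mem hs).pow i)
  induction i with
  | zero => simpa using EdgePath.refl u
  | succ i ih =>
    rw [pow_succ, ← mul_assoc]
    refine (ih (by lia)).step hs ⟨(hw i).mono (by lia), ?_, n - 1, by lia, Or.inl ?_⟩
    · rw [mul_assoc, ← pow_succ]
      exact (hw (i + 1)).mono hi
    · exact (hw i).mono (by lia)

end Lift

namespace Heis

/-- In `⟨x, y⟩` one of two neighbouring elements of a ball lies in the next smaller one. -/
theorem Ball.sub_one_or {n : ℤ} {u s : Heis} (hs : s ∈ steps gens) (hu : Ball n u)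
    (hv : Ball n (u * s)) : Ball (n - 1) u ∨ Ball (n - 1) (u * s) := by
  rw [mem_steps_gens] at hs
  -- The perimeter `2 * (p + q)` is even, so an odd bound `n + |a| + |b|` has one to spare. A step
  -- changes this parity.
  have par : ∀ g : Heis, Ball n g → (n + g.a + g.b) % 2 = 1 → Ball (n - 1) g := by
    rintro g ⟨p, q, h₁, h₂, h₃, h₄⟩ hg
    refine ⟨p, q, h₁, h₂, ?_, h₄⟩
    grind
  by_cases h : (n + u.a + u.b) % 2 = 1
  · exact Or.inl (par u hu h)
  · refine Or.inr (par _ hv ?_)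
    simp only [mul_a, mul_b]
    grind

theorem center_zpow (c k : ℤ) : (⟨0, 0, c⟩ : Heis) ^ k = ⟨0, 0, c * k⟩ := by
  induction k using Int.induction_on with
  | zero => ext <;> simp
  | succ i ih => rw [zpow_add_one, ih]; ext <;> simp; ring
  | pred i ih => rw [zpow_sub_one, ih]; ext <;> simp; ring

theorem X_zpow (k : ℤ) : (X 1) ^ k = X k := by
  induction k using Int.induction_on with
  | zero => ext <;> simp
  | succ i ih => rw [zpow_add_one, ih]; ext <;> simp
  | pred i ih => rw [zpow_sub_one, ih]; ext <;> simp; ring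

theorem Y_zpow (k : ℤ) : (Y 1) ^ k = Y k := by
  induction k using Int.induction_on with
  | zero => ext <;> simp
  | succ i ih => rw [zpow_add_one, ih]; ext <;> simp
  | pred i ih => rw [zpow_sub_one, ih]; ext <;> simp; ring

end Heis

open Heis

/-! ### Coordinates on `N` and its almost convexity -/

section N

/-- The homomorphism from `N` to a group in which two elements have a central commutator. -/
def liftN {G : Type*} [Group G] (x y : G) (h₁ : ⁅⁅x, y⁆, x⁆ = 1) (h₂ : ⁅⁅x, y⁆, y⁆ = 1) : N →* G :=
  PresentedGroup.toGroup (f := ![x, y]) (by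
    rintro r (rfl | rfl)
    · simpa [map_commutatorElement] using h₁
    · simpa [map_commutatorElement] using h₂)

theorem liftN_x {G : Type*} [Group G] (x y : G) (h₁ : ⁅⁅x, y⁆, x⁆ = 1) (h₂ : ⁅⁅x, y⁆, y⁆ = 1) :
    liftN x y h₁ h₂ (PresentedGroup.of 0) = x := by
  simp [liftN]

theorem liftN_y {G : Type*} [Group G] (x y : G) (h₁ : ⁅⁅x, y⁆, x⁆ = 1) (h₂ : ⁅⁅x, y⁆, y⁆ = 1) :
    liftN x y h₁ h₂ (PresentedGroup.of 1) = y := by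
  simp [liftN]

/-- The coordinates of an element of `N`. -/
def coordN : N →* Heis :=
  liftN (X 1) (Y 1) (by ext <;> simp [commutatorElement_def])
    (by ext <;> simp [commutatorElement_def])

/-- The generator `x` of `N`. -/
def xN : N := PresentedGroup.of 0
/-- The generator `y` of `N`. -/
def yN : N := PresentedGroup.of 1

@[simp] theorem coordN_x : coordN xN = X 1 := liftN_x _ _ _ _
@[simp] theorem coordN_y : coordN yN = Y 1 := liftN_y _ _ _ _

theorem gensN_eq : gensN = {xN, yN} := rfl

theorem closure_gensN : Subgroup.closure gensN = ⊤ := by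
  rw [← PresentedGroup.closure_range_of relsN]
  congr 1
  ext g
  simp [gensN, Fin.exists_fin_two, eq_comm]

theorem commute_comm_x : Commute ⁅xN, yN⁆ xN := by
  rw [← commutatorElement_eq_one_iff_commute]
  exact PresentedGroup.one_of_mem (rels := relsN) (Or.inl rfl)

theorem commute_comm_y : Commute ⁅xN, yN⁆ yN := by
  rw [← commutatorElement_eq_one_iff_commute]
  exact PresentedGroup.one_of_mem (rels := relsN) (Or.inr rfl)

/-- Two conjugations, each compatible with powers: `y⁻¹` multiplies `x` by `z`, hence `x ^ a` by `z
^ a`; then `x ^ a` multiplies `y` by `z ^ a`. -/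
theorem zpow_mul_zpow_of_commute {G : Type*} [Group G] {x y z : G} (hx : Commute z x)
    (hy : Commute z y) (h : x * y = z * y * x) (a b : ℤ) :
    x ^ a * y ^ b = z ^ (a * b) * y ^ b * x ^ a := by
  have h₁ : y⁻¹ * x * y⁻¹⁻¹ = z * x := by
    rw [inv_inv, mul_assoc, h, hy.eq]
    group
  have h₂ : y⁻¹ * x ^ a * y⁻¹⁻¹ = z ^ a * x ^ a := by rw [← conj_zpow, h₁, hx.mul_zpow]
  have h₃ : x ^ a * y * (x ^ a)⁻¹ = z ^ a * y := by
    rw [(hy.zpow_left a).eq, mul_inv_eq_iff_eq_mul, mul_assoc, ← h₂]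
    group
  rw [← mul_inv_eq_iff_eq_mul, ← conj_zpow, h₃, (hy.zpow_left a).mul_zpow, zpow_mul]

/-- Every element of `N` is of the form `x ^ a * y ^ b * [x, y] ^ c`. -/
theorem exists_normal_form (g : N) : ∃ a b c : ℤ, g = xN ^ a * yN ^ b * ⁅xN, yN⁆ ^ c := by
  have hxy : xN * yN = ⁅xN, yN⁆ * yN * xN := by simp [commutatorElement_def]
  have mulX : ∀ a b c d : ℤ, xN ^ a * yN ^ b * ⁅xN, yN⁆ ^ c * xN ^ d =
      xN ^ (a + d) * yN ^ b * ⁅xN, yN⁆ ^ (c - d * b) := by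
    intro a b c d
    have h := zpow_mul_zpow_of_commute commute_comm_x commute_comm_y hxy d b
    have hz : Commute ⁅xN, yN⁆ (yN ^ b * xN ^ d) :=
      (commute_comm_y.zpow_right b).mul_right (commute_comm_x.zpow_right d)
    have h' : yN ^ b * xN ^ d = xN ^ d * yN ^ b * ⁅xN, yN⁆ ^ (-(d * b)) := by
      rw [h, mul_assoc (_ ^ (d * b)), mul_assoc (_ ^ (d * b)), ← (hz.zpow_left _).eq, ← mul_assoc,
        ← zpow_add, add_neg_cancel, zpow_zero, one_mul]
    rw [mul_assoc, ((commute_comm_x.zpow_right d).zpow_left c).eq, ← mul_assoc, mul_assoc (xN ^ a),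
      h', zpow_add, sub_eq_add_neg, add_comm c, zpow_add]
    simp only [mul_assoc]
  have mulY : ∀ a b c d : ℤ, xN ^ a * yN ^ b * ⁅xN, yN⁆ ^ c * yN ^ d =
      xN ^ a * yN ^ (b + d) * ⁅xN, yN⁆ ^ c := by
    intro a b c d
    rw [mul_assoc, ((commute_comm_y.zpow_right d).zpow_left c).eq, zpow_add]
    simp only [mul_assoc]
  have hg : g ∈ Subgroup.closure gensN := by simp [closure_gensN]
  induction hg using Subgroup.closure_induction_right with
  | one => exact ⟨0, 0, 0, by simp⟩
  | mul_right u hu s hs ih =>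
    obtain ⟨a, b, c, rfl⟩ := ih
    rw [gensN_eq] at hs
    rcases hs with rfl | rfl
    · exact ⟨_, _, _, by simpa using mulX a b c 1⟩
    · exact ⟨_, _, _, by simpa using mulY a b c 1⟩
  | mul_inv_cancel u hu s hs ih =>
    obtain ⟨a, b, c, rfl⟩ := ih
    rw [gensN_eq] at hs
    rcases hs with rfl | rfl
    · exact ⟨_, _, _, by simpa using mulX a b c (-1)⟩
    · exact ⟨_, _, _, by simpa using mulY a b c (-1)⟩

theorem coordN_comm : coordN ⁅xN, yN⁆ = ⟨0, 0, 2⟩ := by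
  rw [map_commutatorElement, coordN_x, coordN_y]
  ext <;> simp [commutatorElement_def]

/-- The exponents of the normal form can be read off the coordinates. -/
theorem coordN_injective : Function.Injective coordN := by
  rw [injective_iff_map_eq_one]
  intro g hg
  obtain ⟨a, b, c, rfl⟩ := exists_normal_form g
  rw [map_mul, map_mul, map_zpow, map_zpow, map_zpow, coordN_x, coordN_y, coordN_comm, X_zpow,
    Y_zpow, center_zpow] at hg
  have h₁ := congrArg Heis.a hg
  have h₂ := congrArg Heis.b hg
  have h₃ := congrArg Heis.t hg
  simp at h₁ h₂
  subst h₁ h₂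
  simp at h₃
  simp [h₃]

theorem coordN_mem_gens : ∀ s ∈ gensN, coordN s ∈ gens := by
  rintro s (rfl | rfl)
  · exact Or.inl coordN_x
  · exact Or.inr coordN_y

theorem exists_coordN_eq : ∀ s' ∈ gens, ∃ s ∈ gensN, coordN s = s' := by
  rintro s (rfl | rfl)
  · exact ⟨xN, Or.inl rfl, coordN_x⟩
  · exact ⟨yN, Or.inr rfl, coordN_y⟩

theorem even_coordN (g : N) : (coordN g).Even := by
  obtain ⟨k, hk⟩ := exists_wordLE closure_gensN g
  exact Even.of_wordLE (hk.map coordN coordN_mem_gens)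

theorem wordLE_gensN_iff {k : ℕ} {g : N} : WordLE gensN k g ↔ Ball k (coordN g) := by
  constructor
  · intro h
    exact ball_of_wordLE (h.map coordN coordN_mem_gens)
  · intro h
    have p := wordLE_of_ball h (even_coordN g)
    unfold WordLE at p
    rw [← map_one coordN] at p
    obtain ⟨g', e, hp⟩ := EdgePath.lift (E := fun _ _ => True) coordN exists_coordN_eq
      (fun _ _ _ _ => trivial) p
    rwa [coordN_injective e] at hp

/-- Elements of a ball of `N` at bounded distance are joined by a path of bounded length in the
ball. -/
theorem exists_edgePath_gensN (m : ℕ) : ∃ K : ℕ, ∀ (n : ℕ) (g g' : N), WordLE gensN n g →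
    WordLE gensN n g' → WordLE gensN m (g⁻¹ * g') →
    EdgePath gensN (EdgeInBall gensN n) K g g' := by
  obtain ⟨K, hK⟩ := exists_conn m
  refine ⟨K, fun n => ?_⟩
  -- `exists_conn` needs one endpoint on the sphere, so the radius is lowered to the larger of the
  -- two lengths. Unequal lengths do occur in the application to `N^e`.
  have key : ∀ (l : ℕ) (g g' : N), wordLength gensN g = l → wordLength gensN g' ≤ l →
      WordLE gensN m (g⁻¹ * g') → EdgePath gensN (EdgeInBall gensN l) K g g' := by
    intro l g g' hg hg' hw
    have hg₁ := (wordLength_le_iff closure_gensN).1 hg.le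
    have hg₂ := (wordLength_le_iff closure_gensN).1 hg'
    have hmin : ¬ Ball (l - 1) (coordN g) := by
      intro hB
      obtain ⟨j, hj⟩ := Int.eq_ofNat_of_zero_le
        (show (0 : ℤ) ≤ l - 1 by
          linarith [hB.abs_add_abs_le, abs_nonneg (coordN g).a, abs_nonneg (coordN g).b])
      rw [hj] at hB
      have := (wordLength_le_iff closure_gensN).2 (wordLE_gensN_iff.2 hB)
      lia
    have hw' := hw.map coordN coordN_mem_gens
    rw [map_mul, map_inv] at hw'
    have p := hK l _ _ (even_coordN g) (wordLE_gensN_iff.1 hg₁) hmin (wordLE_gensN_iff.1 hg₂) hw'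
    have hE : ∀ u s : N, s ∈ steps gensN →
        Ball l (coordN u) ∧ Ball l (coordN (u * s)) → EdgeInBall gensN l u (u * s) := by
      rintro u s hs ⟨hu, hv⟩
      have hs' := map_mem_steps coordN coordN_mem_gens hs
      refine ⟨wordLE_gensN_iff.2 hu, wordLE_gensN_iff.2 hv, ?_⟩
      rw [map_mul] at hv
      have hor := hu.sub_one_or hs' hv
      rw [← map_mul] at hor
      obtain ⟨j, hj⟩ : ∃ j : ℕ, (l : ℤ) - 1 = j := by
        refine Int.eq_ofNat_of_zero_le ?_
        rcases hor with h | h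
        · linarith [h.abs_add_abs_le, abs_nonneg (coordN u).a, abs_nonneg (coordN u).b]
        · linarith [h.abs_add_abs_le, abs_nonneg (coordN (u * s)).a,
            abs_nonneg (coordN (u * s)).b]
      rw [hj] at hor
      exact ⟨j, by lia, hor.imp wordLE_gensN_iff.2 wordLE_gensN_iff.2⟩
    obtain ⟨g'', e, p'⟩ := EdgePath.lift (E := EdgeInBall gensN l) coordN exists_coordN_eq hE p
    rwa [coordN_injective e] at p'
  intro g g' hg hg' hw
  rw [← wordLength_le_iff closure_gensN] at hg hg'
  rcases le_total (wordLength gensN g') (wordLength gensN g) with h | h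
  · exact (key _ g g' rfl h hw).mono fun _ _ => EdgeInBall.mono hg
  · have hw' := hw.inv
    rw [mul_inv_rev, inv_inv] at hw'
    exact ((key _ g' g rfl h hw').symm EdgeInBall.symm).mono fun _ _ => EdgeInBall.mono hg'

theorem almostConvex_gensN : AlmostConvex gensN where
  finite := by
    rw [gensN_eq]
    exact Set.toFinite _
  generates := closure_gensN
  almostConvexAt m := by
    obtain ⟨K, hK⟩ := exists_edgePath_gensN m
    refine ⟨K, fun n g g' hg hg' hd => ?_⟩
    have h := (wordLength_le_iff closure_gensN).1 hg.le
    have h' := (wordLength_le_iff closure_gensN).1 hg'.le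
    exact (hK n g g' h h' ((wordDist_le_iff closure_gensN).1 hd)).exists_walk_liesInBall
      closure_gensN h

end N

/-! ### Reduction of `N^e` to `N` -/

section Ne

variable (e : ℕ)

/-- The generator `x` of `N^e`. -/
def xE : Ne e := PresentedGroup.of 0
/-- The generator `y` of `N^e`. -/
def yE : Ne e := PresentedGroup.of 1
/-- The generator `z` of `N^e`. -/
def zE : Ne e := PresentedGroup.of 2

theorem gensNe_eq : gensNe e = {xE e, yE e, zE e} := rfl

theorem closure_gensNe : Subgroup.closure (gensNe e) = ⊤ := by
  rw [← PresentedGroup.closure_range_of (relsNe e)]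
  congr 1
  ext g
  simp [gensNe, Fin.exists_fin_succ, eq_comm]

theorem commute_xE_zE : Commute (xE e) (zE e) := by
  rw [← commutatorElement_eq_one_iff_commute]
  exact PresentedGroup.one_of_mem (rels := relsNe e) (Or.inl rfl)

theorem commute_yE_zE : Commute (yE e) (zE e) := by
  rw [← commutatorElement_eq_one_iff_commute]
  exact PresentedGroup.one_of_mem (rels := relsNe e) (Or.inr (Or.inl rfl))

theorem comm_xE_yE : ⁅xE e, yE e⁆ = zE e ^ e :=
  PresentedGroup.mk_eq_mk_of_mul_inv_mem (rels := relsNe e) (Or.inr (Or.inr rfl))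

theorem commute_zE (g : Ne e) : Commute g (zE e) := by
  have : g ∈ Subgroup.centralizer {zE e} := by
    refine PresentedGroup.generated_by (relsNe e) _ (fun j => ?_) g
    rw [Subgroup.mem_centralizer_singleton_iff]
    fin_cases j
    · exact commute_xE_zE e
    · exact commute_yE_zE e
    · rfl
  rwa [Subgroup.mem_centralizer_singleton_iff] at this

/-- The homomorphism from `N` to `N^e` that preserves `x` and `y`. -/
def incl : N →* Ne e :=
  liftN (xE e) (yE e)
    (by
      rw [commutatorElement_eq_one_iff_commute, comm_xE_yE]
      exact ((commute_xE_zE e).pow_right e).symm)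
    (by
      rw [commutatorElement_eq_one_iff_commute, comm_xE_yE]
      exact ((commute_yE_zE e).pow_right e).symm)

theorem incl_x : incl e xN = xE e := liftN_x _ _ _ _
theorem incl_y : incl e yN = yE e := liftN_y _ _ _ _

theorem incl_mem_gensNe : ∀ s ∈ gensN, incl e s ∈ gensNe e := by
  rintro s (rfl | rfl)
  · exact Or.inl (incl_x e)
  · exact Or.inr (Or.inl (incl_y e))

theorem incl_comm : incl e ⁅xN, yN⁆ = zE e ^ e := by
  rw [map_commutatorElement, incl_x, incl_y, comm_xE_yE]

/-- Coordinates on `N^e`, with the first one stretched by the factor `e`. -/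
def coordNe : Ne e →* Heis :=
  PresentedGroup.toGroup (f := ![X e, Y 1, ⟨0, 0, 2⟩]) (by
    rintro r (rfl | rfl | rfl)
    · simp only [map_commutatorElement, FreeGroup.lift_apply_of]
      ext <;> simp [commutatorElement_def]
    · simp only [map_commutatorElement, FreeGroup.lift_apply_of]
      ext <;> simp [commutatorElement_def]
    · rw [map_mul, map_inv, map_commutatorElement, map_pow, mul_inv_eq_one]
      simp only [FreeGroup.lift_apply_of]
      have := center_zpow 2 e
      rw [zpow_natCast] at this
      rw [show (![X e, Y 1, ⟨0, 0, 2⟩] : Fin 3 → Heis) 2 = ⟨0, 0, 2⟩ from rfl, this]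
      ext <;> simp [commutatorElement_def]
      ring)

/-- Stretching of the first coordinate by the factor `e`. -/
def stretch : Heis →* Heis where
  toFun g := ⟨e * g.a, g.b, e * g.t⟩
  map_one' := by ext <;> simp
  map_mul' g h := by ext <;> simp <;> ring

theorem coordNe_incl (g : N) : coordNe e (incl e g) = stretch e (coordN g) := by
  have : (coordNe e).comp (incl e) = (stretch e).comp coordN := by
    ext j : 1
    fin_cases j
    · change coordNe e (incl e xN) = stretch e (coordN xN)
      rw [incl_x, coordN_x]
      simp [coordNe, xE, stretch, X]
    · change coordNe e (incl e yN) = stretch e (coordN yN)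
      rw [incl_y, coordN_y]
      simp [coordNe, yE, stretch, Y]
  exact DFunLike.congr_fun this g

theorem coordNe_zE : coordNe e (zE e) = ⟨0, 0, 2⟩ := by
  simp [coordNe, zE]

variable {e}

/-- In a word in `x`, `y`, `z` the letters `z` can be collected at the end. -/
theorem exists_incl_mul_zpow {n : ℕ} {g : Ne e} (hg : WordLE (gensNe e) n g) :
    ∃ (h : N) (j : ℕ) (k : ℤ), g = incl e h * zE e ^ k ∧ WordLE gensN j h ∧ j + k.natAbs ≤ n := by
  unfold WordLE at hg
  generalize h1 : (1 : Ne e) = g₁ at hg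
  induction hg with
  | refl => exact ⟨1, 0, 0, by simp [← h1], .one _ _, by simp⟩
  | stay _ ih =>
    obtain ⟨h, j, k, h₁, h₂, h₃⟩ := ih h1
    exact ⟨h, j, k, h₁, h₂, by lia⟩
  | @step l g₁ g₂ s _ hs _ ih =>
    obtain ⟨h, j, k, rfl, h₂, h₃⟩ := ih h1
    have base : ∀ s' : N, s' ∈ steps gensN → incl e s' = s → ∃ (h' : N) (j : ℕ) (k' : ℤ),
        incl e h * zE e ^ k * s = incl e h' * zE e ^ k' ∧ WordLE gensN j h' ∧
          j + k'.natAbs ≤ l + 1 := by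
      rintro s' hs' rfl
      refine ⟨h * s', j + 1, k, ?_, h₂.mul (.of_mem hs'), by lia⟩
      rw [map_mul, mul_assoc, mul_assoc, ((commute_zE e (incl e s')).zpow_right k).eq]
    rw [gensNe_eq] at hs
    rcases hs with hs | hs
    · rcases hs with rfl | rfl | rfl
      · exact base xN (Or.inl (Or.inl rfl)) (incl_x e)
      · exact base yN (Or.inl (Or.inr rfl)) (incl_y e)
      · exact ⟨h, j, k + 1, by rw [mul_assoc, ← zpow_add_one], h₂, by lia⟩
    · rcases hs with hs | hs | hs
      · refine base xN⁻¹ (inv_mem_steps (Or.inl (Or.inl rfl))) ?_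
        rw [map_inv, incl_x, ← inv_inv s, hs]
      · refine base yN⁻¹ (inv_mem_steps (Or.inl (Or.inr rfl))) ?_
        rw [map_inv, incl_y, ← inv_inv s, hs]
      · refine ⟨h, j, k - 1, ?_, h₂, by lia⟩
        rw [mul_assoc, zpow_sub_one, ← inv_inv s, hs]

/-- A 5 × 5 square has area 25 and perimeter 20. Replacing `25 * e` letters `z` by 20 letters thus
shortens a word whenever `e ≥ 1`, which bounds the exponent of `z`. -/
theorem wordLE_comm_pow : WordLE gensN 20 (⁅xN, yN⁆ ^ 25) := by
  rw [wordLE_gensN_iff, map_pow, coordN_comm]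
  have := center_zpow 2 (25 : ℕ)
  rw [zpow_natCast] at this
  rw [this]
  exact ⟨5, 5, by simp⟩

/-- As `exists_incl_mul_zpow`, with a bounded power of `z`. -/
theorem exists_incl_mul_zpow_le (he : 1 ≤ e) {n : ℕ} {g : Ne e} (hg : WordLE (gensNe e) n g) :
    ∃ (h : N) (j : ℕ) (k : ℤ), g = incl e h * zE e ^ k ∧ WordLE gensN j h ∧ j + k.natAbs ≤ n ∧
      k.natAbs ≤ 25 * e := by
  obtain ⟨h, j, k, h₁, h₂, h₃⟩ := exists_incl_mul_zpow hg
  have hz : incl e (⁅xN, yN⁆ ^ 25) = zE e ^ (25 * e : ℤ) := by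
    rw [map_pow, incl_comm, ← pow_mul, ← zpow_natCast]
    push_cast
    rw [mul_comm]
  induction hk : k.natAbs using Nat.strong_induction_on generalizing h j k with
  | _ K ih =>
    rcases le_or_gt K (25 * e) with hK | hK
    · exact ⟨h, j, k, h₁, h₂, h₃, by lia⟩
    · rcases le_total 0 k with hk0 | hk0
      · refine ih _ ?_ (h * ⁅xN, yN⁆ ^ 25) (j + 20) (k - 25 * e) ?_ (h₂.mul wordLE_comm_pow)
          (by lia) rfl
        · lia
        · rw [map_mul, hz, mul_assoc, ← zpow_add, add_sub_cancel, h₁]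
      · refine ih _ ?_ (h * (⁅xN, yN⁆ ^ 25)⁻¹) (j + 20) (k + 25 * e) ?_
          (h₂.mul wordLE_comm_pow.inv) (by lia) rfl
        · lia
        · rw [map_mul, map_inv, hz, mul_assoc, ← zpow_neg, ← zpow_add,
            neg_add_cancel_comm_assoc, h₁]

/-- The inclusion of `N` in `N^e` distorts lengths by a bounded factor. -/
theorem wordLE_of_incl (he : 1 ≤ e) {L : ℕ} {u : N} (hu : WordLE (gensNe e) L (incl e u)) :
    WordLE gensN (4 * L) u := by
  obtain ⟨h, j, k, h₁, h₂, h₃⟩ := exists_incl_mul_zpow hu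
  have h₄ : incl e (h⁻¹ * u) = zE e ^ k := by rw [map_mul, map_inv, h₁, inv_mul_cancel_left]
  have h₅ := congrArg (coordNe e) h₄
  rw [coordNe_incl, map_zpow, coordNe_zE, center_zpow] at h₅
  have ha : e * (coordN (h⁻¹ * u)).a = 0 := congrArg Heis.a h₅
  have hb : (coordN (h⁻¹ * u)).b = 0 := congrArg Heis.b h₅
  have ht : e * (coordN (h⁻¹ * u)).t = 2 * k := congrArg Heis.t h₅
  have he' : (1 : ℤ) ≤ e := by exact_mod_cast he
  have ha' : (coordN (h⁻¹ * u)).a = 0 := by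
    rcases mul_eq_zero.1 ha with h | h
    · lia
    · exact h
  -- For a power of `z` coming from `N`, `|t| ≤ 2|k| ≤ 2k²`, which fits a square box of side `|k|`.
  have hw : WordLE gensN (4 * k.natAbs) (h⁻¹ * u) := by
    rw [wordLE_gensN_iff]
    push_cast
    refine ball_of_abs_le (by rw [ha']; simp) (by rw [hb]; simp) ?_
    rw [ha', hb, abs_zero, zero_mul, add_zero]
    have h6 : |(coordN (h⁻¹ * u)).t| ≤ 2 * |k| := by
      have : (e : ℤ) * |(coordN (h⁻¹ * u)).t| = 2 * |k| := by
        have := congrArg abs ht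
        rw [abs_mul, abs_mul] at this
        simpa using this
      nlinarith [abs_nonneg (coordN (h⁻¹ * u)).t]
    have h7 : |k| ≤ |k| ^ 2 := by
      have := Int.le_self_sq |k|
      exact this
    linarith
  have := h₂.mul hw
  rw [mul_inv_cancel_left] at this
  exact this.mono (by lia)

/-- The length bound grows by one per letter, so the edges stay in the ball, interiors included.
Read backwards, the path strips the power of `z`. -/
theorem edgePath_zpow {j n : ℕ} {u : Ne e} (hu : WordLE (gensNe e) j u) (k : ℤ)
    (hk : j + k.natAbs ≤ n) :
    EdgePath (gensNe e) (EdgeInBall (gensNe e) n) k.natAbs u (u * zE e ^ k) := by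
  have hz : zE e ∈ steps (gensNe e) := Or.inl (Or.inr (Or.inr rfl))
  rcases Int.natAbs_eq k with h | h
  · have := edgePath_pow hz hu k.natAbs hk
    rwa [← zpow_natCast, ← h] at this
  · have := edgePath_pow (inv_mem_steps hz) hu k.natAbs hk
    rwa [← zpow_natCast, inv_zpow', ← h] at this

theorem almostConvex_gensNe (he : 1 ≤ e) : AlmostConvex (gensNe e) where
  finite := by
    rw [gensNe_eq]
    exact Set.toFinite _
  generates := closure_gensNe e
  almostConvexAt m := by
    -- Stripping the powers of `z` adds at most `25 * e` at each end to the distance `m`; measuring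
    -- in `N` costs the factor 4.
    obtain ⟨K, hK⟩ := exists_edgePath_gensN (4 * (25 * e + m + 25 * e))
    refine ⟨25 * e + K + 25 * e, fun n g g' hg hg' hd => ?_⟩
    have hw := (wordLength_le_iff (closure_gensNe e)).1 hg.le
    have hw' := (wordLength_le_iff (closure_gensNe e)).1 hg'.le
    have hwd := (wordDist_le_iff (closure_gensNe e)).1 hd
    refine EdgePath.exists_walk_liesInBall (closure_gensNe e) hw ?_
    obtain ⟨h, j, k, e₁, b₁, c₁, d₁⟩ := exists_incl_mul_zpow_le he hw
    obtain ⟨h', j', k', e₂, b₂, c₂, d₂⟩ := exists_incl_mul_zpow_le he hw'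
    have p := edgePath_zpow (b₁.map (incl e) (incl_mem_gensNe e)) k c₁
    have p' := edgePath_zpow (b₂.map (incl e) (incl_mem_gensNe e)) k' c₂
    have hz : ∀ i : ℤ, WordLE (gensNe e) i.natAbs (zE e ^ i) := fun i => by
      have := (edgePath_zpow (WordLE.one (gensNe e) 0) i le_rfl).wordLE
      simpa using this
    rw [← e₁] at p
    rw [← e₂] at p'
    have hd' : WordLE gensN (4 * (25 * e + m + 25 * e)) (h⁻¹ * h') := by
      refine wordLE_of_incl he ?_
      have := (((hz k).mono d₁).mul hwd).mul ((hz k').inv.mono d₂)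
      convert this using 1
      rw [e₁, e₂, map_mul, map_inv]
      group
    have q := (hK n h h' (b₁.mono (by lia)) (b₂.mono (by lia)) hd').map_hom
      (E' := EdgeInBall (gensNe e) n) (incl e) (incl_mem_gensNe e)
      fun _ _ => EdgeInBall.map (incl e) (incl_mem_gensNe e)
    exact (((p.symm EdgeInBall.symm).trans q).trans p').mono_length (by lia)

end Ne

end Nil

theorem theorem3 :
    Nil.AlmostConvex Nil.gensN ∧
      ∀ e : ℕ, 1 ≤ e → Nil.AlmostConvex (Nil.gensNe e) :=
  ⟨Nil.almostConvex_gensN, fun _ he => Nil.almostConvex_gensNe he⟩
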